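/- Let $R=\bigoplus_{n\in\mathbb Z}R_n$ be a commutative Noetherian $\mathbb Z$-graded ring which is a local graded ring: it has a proper homogeneous ideal $\mathfrak m$ containing every proper homogeneous ideal. Write $\kappa=R/\mathfrak m$. Regard $R$ as a DG algebra with zero differential (homological grading), and let $\mathcal D(R)$ be the derived category of DG $R$-modules, i.e. the localization of the category of DG $R$-modules at the quasi-isomorphisms. A DG module $M$ is small if $\mathrm{Hom}_{\mathcal D(R)}(M,-)$ commutes with arbitrary direct sums. A finite free resolution of a (graded) module $M$ is an exact sequence $0\to F_n\to\cdots\to F_0\to M\to 0$ of (graded) modules in which every $F_i$ is (graded) free of finite rank. (1) For every finitely generated graded $R$-module $M$ the following are equivalent: (i) $M$, with zero differential, is small as a DG $R$-module; (ii) $M$ has a finite free resolution as a graded $R$-module; (iii) the ungraded localization $M_{\mathfrak m}$ has a finite free resolution over $R_{\mathfrak m}$; (iv) the completion $M_{\mathfrak m}^\wedge$ of $M_{\mathfrak m}$ with respect to the maximal ideal of $R_{\mathfrak m}$ has a finite free resolution over $R_{\mathfrak m}^\wedge$. (2) $R$ is regular as a formal DG algebra (every DG $R$-module whose homology is a finitely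 generated $R$-module is small) if and only if $R$ is regular as a local graded ring, i.e. $\mathfrak m$ is generated by $\mathrm{height}(\mathfrak m)$ homogeneous elements, and if and only if the ungraded local ring $R_{\mathfrak m}$ is regular. (3) If $\kappa$ is a field, then $R$ is regular as a formal DG algebra if and only if it is regular as a ring spectrum augmented over $\kappa$ in the sense of Dwyer, Greenlees and Iyengar, i.e. $\kappa$ is small as a DG $R$-module. (4) If $k$ is a field and $R$ is a graded $k$-algebra (with $k$ mapping to $R_0$) generated over $k$ by homogeneous elements that are all of positive degree, or all of negative degree, then the following are equivalent: $R$ is regular as a formal DG algebra; $R$ is a polynomial ring over $k$ on finitely many homogeneous generators; $R$ is isomorphic, as an ungraded $k$-algebra, to a polynomial ring $k[x_1,\dots,x_n]$ for some $n\ge 0$. -/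

import Mathlib

open CategoryTheory

universe u v

/-! ### Graded modules

A `ℤ`-graded commutative ring is a commutative ring `R` with a family of additive subgroups
`𝒜 : ℤ → AddSubgroup R` and `[GradedRing 𝒜]`. -/

/-- A `ℤ`-graded module over the graded ring `(R, 𝒜)`: an `R`-module which is the internal direct
sum of its homogeneous components, with `𝒜 i • M_j ⊆ M_{i+j}`. -/
structure GrMod {R : Type u} [CommRing R] (𝒜 : ℤ → AddSubgroup R) : Type (u + 1) where
  carrier : Type u
  [addCommGroup : AddCommGroup carrier]
  [module : Module R carrier]
  grading : ℤ → AddSubgroup carrier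
  isInternal : DirectSum.IsInternal grading
  smul_mem : ∀ {i j : ℤ} {r : R} {x : carrier},
    r ∈ 𝒜 i → x ∈ grading j → r • x ∈ grading (i + j)

attribute [instance] GrMod.addCommGroup GrMod.module

namespace GrMod

variable {R : Type u} [CommRing R] {𝒜 : ℤ → AddSubgroup R}

/-- Morphisms of graded modules: linear maps of degree zero. -/
structure Hom (M N : GrMod 𝒜) where
  toLinearMap : M.carrier →ₗ[R] N.carrier
  map_mem : ∀ {n : ℤ} {x : M.carrier}, x ∈ M.grading n → toLinearMap x ∈ N.grading n

/-- A finite free graded module: one with a finite basis of homogeneous elements, that is, a finite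
direct sum of shifts of `R`. -/
def IsFiniteFree (M : GrMod 𝒜) : Prop :=
  ∃ (r : ℕ) (b : Module.Basis (Fin r) R M.carrier), ∀ i, ∃ n : ℤ, b i ∈ M.grading n

/-- `M` has a finite free resolution as a graded module: there is an exact sequence
`0 → F n → ⋯ → F 1 → F 0 → M → 0` of graded modules with all `F i` finite free. -/
def HasFiniteFreeResolution (M : GrMod 𝒜) : Prop :=
  ∃ (n : ℕ) (F : ℕ → GrMod 𝒜) (d : ∀ i, Hom (F (i + 1)) (F i)) (ε : Hom (F 0) M),
    (∀ i, (F i).IsFiniteFree) ∧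
    (∀ i, n < i → Subsingleton (F i).carrier) ∧
    Function.Surjective ε.toLinearMap ∧
    Function.Exact (d 0).toLinearMap ε.toLinearMap ∧
    ∀ i, Function.Exact (d (i + 1)).toLinearMap (d i).toLinearMap

end GrMod

/-- An (ungraded) module `M` over a commutative ring `A` has a finite free resolution: there is an
exact sequence `0 → A ^ r n → ⋯ → A ^ r 0 → M → 0`. -/
def HasFiniteFreeResolution (A : Type*) [CommRing A] (M : Type*) [AddCommGroup M] [Module A M] :
    Prop :=
  ∃ (n : ℕ) (r : ℕ → ℕ) (d : ∀ i, (Fin (r (i + 1)) → A) →ₗ[A] (Fin (r i) → A))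
    (ε : (Fin (r 0) → A) →ₗ[A] M),
    (∀ i, n < i → r i = 0) ∧
    Function.Surjective ε ∧
    Function.Exact (d 0) ε ∧
    ∀ i, Function.Exact (d (i + 1)) (d i)

/-! ### Differential graded modules over a formal DG algebra -/

/-- A differential graded module over the DG algebra `R` with zero differential, with homological
grading. As `R` is commutative, modules are right modules, for which the Leibniz rule
`d (x r) = (d x) r + (-1)^|x| x (d r)` says, since `d r = 0`, that `d` is `R`-linear. -/
structure DGMod {R : Type u} [CommRing R] (𝒜 : ℤ → AddSubgroup R) : Type (u + 1)
    extends GrMod 𝒜 where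
  d : carrier →ₗ[R] carrier
  d_mem : ∀ {n : ℤ} {x : carrier}, x ∈ grading n → d x ∈ grading (n - 1)
  d_d : ∀ x : carrier, d (d x) = 0

namespace DGMod

variable {R : Type u} [CommRing R] {𝒜 : ℤ → AddSubgroup R}

/-- Morphisms of DG modules: linear chain maps of degree zero. -/
@[ext]
structure Hom (M N : DGMod 𝒜) where
  toLinearMap : M.carrier →ₗ[R] N.carrier
  map_mem : ∀ {n : ℤ} {x : M.carrier}, x ∈ M.grading n → toLinearMap x ∈ N.grading n
  map_d : ∀ x : M.carrier, toLinearMap (M.d x) = N.d (toLinearMap x)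

instance : Category (DGMod 𝒜) where
  Hom M N := Hom M N
  id M := ⟨LinearMap.id, fun h => h, fun _ => rfl⟩
  comp f g := ⟨g.toLinearMap ∘ₗ f.toLinearMap, fun h => g.map_mem (f.map_mem h),
    fun x => by simp [f.map_d, g.map_d]⟩

/-- The total homology `ker d / im d` of a DG module, an `R`-module. -/
abbrev Homology (M : DGMod 𝒜) : Type u :=
  LinearMap.ker M.d ⧸ (LinearMap.range M.d).submoduleOf (LinearMap.ker M.d)

/-- The map induced on cycles. -/
def cyclesMap {M N : DGMod 𝒜} (f : M ⟶ N) : LinearMap.ker M.d →ₗ[R] LinearMap.ker N.d :=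
  (Hom.toLinearMap f).restrict fun x hx => by
    rw [LinearMap.mem_ker] at hx ⊢
    rw [← Hom.map_d f x, hx, map_zero]

/-- The map induced on homology. -/
def homologyMap {M N : DGMod 𝒜} (f : M ⟶ N) : M.Homology →ₗ[R] N.Homology :=
  Submodule.mapQ _ _ (cyclesMap f) fun x hx => by
    obtain ⟨y, hy⟩ := hx
    exact ⟨Hom.toLinearMap f y, (Hom.map_d f y).symm.trans (congrArg (Hom.toLinearMap f) hy)⟩

variable (𝒜) in
/-- Quasi-isomorphisms: the morphisms inducing an isomorphism on homology. -/
def quasiIso : MorphismProperty (DGMod 𝒜) :=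
  fun _ _ f => Function.Bijective (homologyMap f)

variable (𝒜) in
/-- The derived category of DG modules: the localization at the quasi-isomorphisms. -/
abbrev Derived : Type (u + 1) := (quasiIso 𝒜).Localization

variable (𝒜) in
/-- The localization functor from DG modules to their derived category. -/
abbrev Q : DGMod 𝒜 ⥤ Derived 𝒜 := (quasiIso 𝒜).Q

open scoped DirectSum in
/-- The direct sum of a family of DG modules, with componentwise grading and differential. -/
noncomputable def directSum {ι : Type u} (X : ι → DGMod 𝒜) : DGMod 𝒜 where
  carrier := ⨁ i, (X i).carrier
  grading n :=
    { carrier := {x | ∀ i, x i ∈ (X i).grading n}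
      add_mem' := fun hx hy i => add_mem (hx i) (hy i)
      zero_mem' := fun _ => zero_mem _
      neg_mem' := fun hx i => neg_mem (hx i) }
  isInternal := by
    classical
    constructor
    · rw [injective_iff_map_eq_zero]
      intro y hy
      refine DFinsupp.ext fun n => Subtype.ext (DFinsupp.ext fun i => ?_)
      let G : ℤ → AddSubgroup (⨁ i, (X i).carrier) := fun n =>
        { carrier := {x | ∀ i, x i ∈ (X i).grading n}
          add_mem' := fun hx hy i => add_mem (hx i) (hy i)
          zero_mem' := fun _ => zero_mem _
          neg_mem' := fun hx i => neg_mem (hx i) }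
      let φ : ∀ n : ℤ, G n →+ (X i).grading n := fun n =>
        { toFun := fun z => ⟨z.1 i, z.2 i⟩, map_zero' := rfl, map_add' := fun _ _ => rfl }
      have hcomm : ∀ z : ⨁ n, G n, DirectSum.coeAddMonoidHom (X i).grading (DirectSum.map φ z) =
          (DirectSum.coeAddMonoidHom G z) i := by
        intro z
        induction z using DirectSum.induction_on with
        | zero => simp
        | of n x =>
          rw [DirectSum.map_of, DirectSum.coeAddMonoidHom_of, DirectSum.coeAddMonoidHom_of]
          rfl
        | add x y hx hy => rw [map_add, map_add, map_add, hx, hy, DirectSum.add_apply]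
      have h0 : DirectSum.map φ y = 0 := (X i).isInternal.1 (by rw [hcomm, hy, map_zero]; rfl)
      have := congrArg (fun w => (w n : (X i).carrier)) h0
      simp only [φ, DirectSum.map_apply, DirectSum.zero_apply] at this
      exact this
    · intro x
      induction x using DirectSum.induction_on with
      | zero => exact ⟨0, map_zero _⟩
      | of i x =>
        obtain ⟨z, rfl⟩ := (X i).isInternal.2 x
        induction z using DirectSum.induction_on with
        | zero => exact ⟨0, by simp⟩
        | of n x =>
          refine ⟨DirectSum.of _ n ⟨DirectSum.of (fun i => (X i).carrier) i x.1, fun j => ?_⟩, ?_⟩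
          · by_cases h : i = j
            · subst h
              rw [DirectSum.of_eq_same]
              exact x.2
            · rw [DirectSum.of_eq_of_ne _ _ _ (Ne.symm h)]
              exact zero_mem _
          · rw [DirectSum.coeAddMonoidHom_of, DirectSum.coeAddMonoidHom_of]
        | add x y hx hy =>
          obtain ⟨a, ha⟩ := hx
          obtain ⟨b, hb⟩ := hy
          exact ⟨a + b, by rw [map_add, ha, hb, map_add, map_add]⟩
      | add x y hx hy =>
        obtain ⟨a, rfl⟩ := hx
        obtain ⟨b, rfl⟩ := hy
        exact ⟨a + b, map_add _ _ _⟩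
  smul_mem hr hx i := (X i).smul_mem hr (hx i)
  d := DirectSum.lmap fun i => (X i).d
  d_mem hx i := (X i).d_mem (hx i)
  d_d x := DFinsupp.ext fun i => (X i).d_d (x i)

open scoped Classical in
/-- The inclusion of the direct sum of a finite subfamily, as a linear map. -/
noncomputable def directSumInclLinear {ι : Type u} (X : ι → DGMod 𝒜) (s : Finset ι) :
    DirectSum s (fun i => (X i).carrier) →ₗ[R] DirectSum ι (fun i => (X i).carrier) :=
  DirectSum.toModule R s _ fun i => DirectSum.lof R ι (fun i => (X i).carrier) i

open scoped Classical in
theorem directSumInclLinear_apply {ι : Type u} (X : ι → DGMod 𝒜) (s : Finset ι)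
    (x : DirectSum s fun i => (X i).carrier) (j : ι) :
    directSumInclLinear X s x j = if h : j ∈ s then x ⟨j, h⟩ else 0 := by
  induction x using DirectSum.induction_on with
  | zero => simp
  | of i y =>
    rw [directSumInclLinear, ← DirectSum.lof_eq_of R, DirectSum.toModule_lof]
    obtain ⟨i, hi⟩ := i
    by_cases hij : i = j
    · subst hij
      rw [DirectSum.lof_apply, dif_pos hi, DirectSum.lof_apply]
    · rw [DirectSum.lof_eq_of, DirectSum.of_eq_of_ne _ _ _ (Ne.symm hij)]
      split_ifs with h
      · rw [DirectSum.lof_eq_of, DirectSum.of_eq_of_ne]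
        exact fun h' => hij (congrArg Subtype.val h').symm
      · rfl
  | add x y hx hy =>
    rw [map_add, DirectSum.add_apply, hx, hy]
    split_ifs <;> simp

/-- The inclusion of the direct sum of a finite subfamily into the direct sum of a family. -/
noncomputable def directSumIncl {ι : Type u} (X : ι → DGMod 𝒜) (s : Finset ι) :
    directSum (fun i : s => X i) ⟶ directSum X where
  toLinearMap := directSumInclLinear X s
  map_mem := by
    intro n x hx j
    have h := directSumInclLinear_apply X s x j
    split_ifs at h with hj
    · exact h ▸ hx ⟨j, hj⟩
    · exact h ▸ zero_mem _
  map_d := by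
    intro x
    refine DFinsupp.ext fun j => ?_
    refine (directSumInclLinear_apply X s (DirectSum.lmap (fun i : s => (X i).d) x) j).trans ?_
    refine Eq.trans ?_ (congrArg (X j).d (directSumInclLinear_apply X s x j)).symm
    split_ifs with h
    · rfl
    · rw [map_zero]

/-- A DG module `M` is small (compact) if `Hom(M, -)` in the derived category commutes with
arbitrary direct sums: every morphism from `M` to a direct sum `⨁ i, X i` in the derived category
factors through the direct sum of finitely many of the `X i`. (Injectivity of
`⨁ i, Hom(M, X i) → Hom(M, ⨁ i, X i)` is automatic, by projecting to the summands.) -/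
def IsSmall (M : DGMod 𝒜) : Prop :=
  ∀ (ι : Type u) (X : ι → DGMod 𝒜) (f : (Q 𝒜).obj M ⟶ (Q 𝒜).obj (directSum X)),
    ∃ (s : Finset ι) (g : (Q 𝒜).obj M ⟶ (Q 𝒜).obj (directSum fun i : s => X i)),
      g ≫ (Q 𝒜).map (directSumIncl X s) = f

/-- A graded module as a DG module with zero differential. -/
def ofGrMod (M : GrMod 𝒜) : DGMod 𝒜 where
  toGrMod := M
  d := 0
  d_mem _ := zero_mem _
  d_d _ := rfl

end DGMod

/-! ### Local graded rings and regularity -/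

section LocalGraded

variable {R : Type u} [CommRing R] (𝒜 : ℤ → AddSubgroup R) [GradedRing 𝒜]

/-- `(R, m)` is a local graded ring: `m` is the unique maximal homogeneous ideal, i.e. it is proper
and contains every proper homogeneous ideal. -/
class IsLocalGraded (m : HomogeneousIdeal 𝒜) : Prop where
  ne_top : m.toIdeal ≠ ⊤
  le_of_ne_top : ∀ I : HomogeneousIdeal 𝒜, I.toIdeal ≠ ⊤ → I.toIdeal ≤ m.toIdeal

instance IsLocalGraded.isPrime (m : HomogeneousIdeal 𝒜) [hm : IsLocalGraded 𝒜 m] :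
    m.toIdeal.IsPrime := by
  refine m.isHomogeneous.isPrime_of_homogeneous_mem_or_mem hm.ne_top ?_
  intro x y hx hy hxy
  by_contra! h
  have hspan : ∀ z, SetLike.IsHomogeneousElem 𝒜 z → z ∉ m.toIdeal → Ideal.span {z} ⊔ m.toIdeal = ⊤ := by
    intro z hz hzm
    by_contra hne
    have hh : (Ideal.span {z} ⊔ m.toIdeal).IsHomogeneous 𝒜 :=
      (Ideal.homogeneous_span 𝒜 {z} (by simpa using hz)).sup m.isHomogeneous
    exact hzm (hm.le_of_ne_top ⟨_, hh⟩ hne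
      (Ideal.mem_sup_left (Ideal.mem_span_singleton_self z)))
  have h1 : (1 : R) ∈ Ideal.span {x} ⊔ m.toIdeal := by rw [hspan x hx h.1]; trivial
  obtain ⟨a, ha, b, hb, hab⟩ := Submodule.mem_sup.1 h1
  obtain ⟨c, rfl⟩ := Ideal.mem_span_singleton'.1 ha
  refine h.2 ?_
  have : y = c * (x * y) + b * y := by linear_combination (-y) * hab
  rw [this]
  exact add_mem (Ideal.mul_mem_left _ _ hxy) (Ideal.mul_mem_right _ _ hb)

/-- The grading on the quotient `R / m` by a homogeneous ideal: the images of the components. -/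
def quotientGrading (m : HomogeneousIdeal 𝒜) (n : ℤ) : AddSubgroup (R ⧸ m.toIdeal) :=
  (𝒜 n).map (Ideal.Quotient.mk m.toIdeal).toAddMonoidHom

theorem quotientGrading_isInternal (m : HomogeneousIdeal 𝒜) :
    DirectSum.IsInternal (quotientGrading 𝒜 m) := by
  classical
  let π : ∀ n : ℤ, 𝒜 n →+ quotientGrading 𝒜 m n := fun n =>
    { toFun := fun a => ⟨Ideal.Quotient.mk m.toIdeal a, ⟨a, a.2, rfl⟩⟩
      map_zero' := Subtype.ext (map_zero _)
      map_add' := fun _ _ => Subtype.ext (map_add _ _ _) }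
  have hπ : ∀ n, Function.Surjective (π n) := by
    rintro n ⟨_, a, ha, rfl⟩
    exact ⟨⟨a, ha⟩, rfl⟩
  have hcomm : ∀ y : DirectSum ℤ fun n => 𝒜 n,
      DirectSum.coeAddMonoidHom (quotientGrading 𝒜 m) (DirectSum.map π y) =
        Ideal.Quotient.mk m.toIdeal (DirectSum.coeAddMonoidHom 𝒜 y) := by
    intro y
    induction y using DirectSum.induction_on with
    | zero => simp
    | of n x =>
      rw [DirectSum.map_of, DirectSum.coeAddMonoidHom_of, DirectSum.coeAddMonoidHom_of]
      rfl
    | add x y hx hy => rw [map_add, map_add, map_add, map_add, hx, hy]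
  constructor
  · rw [injective_iff_map_eq_zero]
    intro z hz
    obtain ⟨y, rfl⟩ := (DirectSum.map_surjective π).2 hπ z
    rw [hcomm, Ideal.Quotient.eq_zero_iff_mem] at hz
    refine DFinsupp.ext fun n => Subtype.ext ?_
    have h1 := m.isHomogeneous n hz
    have h2 : DirectSum.decompose 𝒜 (DirectSum.coeAddMonoidHom 𝒜 y) = y :=
      DirectSum.Decomposition.right_inv y
    rw [h2] at h1
    rw [DirectSum.map_apply]
    exact Ideal.Quotient.eq_zero_iff_mem.2 h1
  · intro x
    obtain ⟨r, rfl⟩ := Ideal.Quotient.mk_surjective x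
    refine ⟨DirectSum.map π (DirectSum.decompose 𝒜 r), ?_⟩
    rw [hcomm]
    exact congrArg _ (DirectSum.Decomposition.left_inv r)

/-- The quotient `R / m` by a homogeneous ideal, as a graded module. -/
def GrMod.quotient (m : HomogeneousIdeal 𝒜) : GrMod 𝒜 where
  carrier := R ⧸ m.toIdeal
  grading := quotientGrading 𝒜 m
  isInternal := quotientGrading_isInternal 𝒜 m
  smul_mem := by
    rintro i j r _ hr ⟨x, hx, rfl⟩
    exact ⟨r * x, SetLike.mul_mem_graded hr hx, by simp [Algebra.smul_def]⟩

/-- `R` is regular as a formal DG algebra: every DG module with finitely generated homology is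
small. -/
def IsRegularDGAlgebra : Prop :=
  ∀ M : DGMod 𝒜, Module.Finite R M.Homology → M.IsSmall

/-- `R` is regular as a local graded ring: its maximal homogeneous ideal `m` is generated by
`height m` homogeneous elements. -/
def IsRegularLocalGraded (m : HomogeneousIdeal 𝒜) : Prop :=
  ∃ (n : ℕ) (x : Fin n → R), (∀ i, SetLike.IsHomogeneousElem 𝒜 (x i)) ∧
    Ideal.span (Set.range x) = m.toIdeal ∧ m.toIdeal.height = n

/-- Regularity of an augmented ring spectrum `R → κ` in the sense of Dwyer, Greenlees and Iyengar,
for the formal DG algebra `R` and its augmentation onto `κ = R / m`: `κ` is small over `R`. -/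
def IsRegularAugmented (m : HomogeneousIdeal 𝒜) : Prop :=
  (DGMod.ofGrMod (GrMod.quotient 𝒜 m)).IsSmall

/-- `R` is a graded polynomial ring over `k`: a polynomial algebra on finitely many homogeneous
generators. -/
def IsGradedPolynomialRing (k : Type v) [Field k] [Algebra k R] : Prop :=
  ∃ (n : ℕ) (e : MvPolynomial (Fin n) k ≃ₐ[k] R),
    ∀ i, SetLike.IsHomogeneousElem 𝒜 (e (MvPolynomial.X i))

/-- `R` is a graded `k`-algebra (the scalars have degree zero), generated over `k` by homogeneous
elements which all have positive degree, or all have negative degree. -/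
def IsGeneratedInOneSign (k : Type v) [Field k] [Algebra k R] : Prop :=
  (∀ a : k, algebraMap k R a ∈ 𝒜 0) ∧
    (Algebra.adjoin k {x : R | ∃ n : ℤ, 0 < n ∧ x ∈ 𝒜 n} = ⊤ ∨
      Algebra.adjoin k {x : R | ∃ n : ℤ, n < 0 ∧ x ∈ 𝒜 n} = ⊤)

end LocalGraded

/-! If the localized (or completed) homology of a DG module `M` has finite projective dimension,
then `M` is small: map a finite free DG module onto the homology of `M`, pass to the cone, and
induct on the projective dimension; flatness and graded Nakayama replace `R` by the local ring.
Conversely, a finitely generated graded module `M` has a minimal graded free resolution `F`, whose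
totalization is K-projective and quasi-isomorphic to `M`. If `M` is small, the map from this
totalization to a direct sum of shifted copies of `R / m` which picks the first basis element of
each nonzero `F n` is homotopic to one with finitely many nonzero components. By minimality a
null-homotopic map to a shift of `R / m` vanishes, so only finitely many `F n` are nonzero.

Applied to `R / m`, this reduces regularity to Serre's theorem for the local ring at `m`. That
ring has the same minimal number of generators of its maximal ideal as the homogeneous ideal `m`.
A regular algebra generated in degrees of one sign is a quotient of a polynomial ring in
`height m` variables, and Krull dimension leaves no room for a kernel. -/

/-! ### Projective dimension -/

section ProjectiveDimension

/-- The projective dimension of the `A`-module `M` is smaller than `n`, so that `n = 0` means that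
`M` is zero and `n = 1` that `M` is projective. -/
abbrev ProjDimLT (A : Type u) [CommRing A] (M : Type u) [AddCommGroup M] [Module A M] (n : ℕ) :
    Prop :=
  HasProjectiveDimensionLT (ModuleCat.of A M) n

variable {A : Type u} [CommRing A] {K F M N : Type u} [AddCommGroup K] [Module A K]
  [AddCommGroup F] [Module A F] [AddCommGroup M] [Module A M] [AddCommGroup N] [Module A N]

theorem projDimLT_zero_iff : ProjDimLT A M 0 ↔ Subsingleton M := by
  rw [ProjDimLT, hasProjectiveDimensionLT_zero_iff_isZero, ModuleCat.isZero_iff_subsingleton]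

theorem projDimLT_one_iff : ProjDimLT A M 1 ↔ Module.Projective A M := by
  rw [ProjDimLT, ← projective_iff_hasProjectiveDimensionLT_one, ← IsProjective.iff_projective]

namespace ProjDimLT

theorem mono {n k : ℕ} (h : ProjDimLT A M n) (hk : n ≤ k) : ProjDimLT A M k :=
  have := h
  hasProjectiveDimensionLT_of_ge _ n k hk

theorem of_projective [Module.Projective A M] (n : ℕ) : ProjDimLT A M (n + 1) :=
  (projDimLT_one_iff.2 ‹_›).mono (Nat.le_add_left 1 n)

theorem of_retract {n : ℕ} (h : ProjDimLT A M n) (i : N →ₗ[A] M) (r : M →ₗ[A] N)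
    (hri : r ∘ₗ i = LinearMap.id) : ProjDimLT A N n :=
  have := h
  Retract.hasProjectiveDimensionLT (X := ModuleCat.of A N) (Y := ModuleCat.of A M)
    ⟨ModuleCat.ofHom i, ModuleCat.ofHom r, by rw [← ModuleCat.ofHom_comp, hri]; rfl⟩ n

theorem of_equiv {n : ℕ} (h : ProjDimLT A M n) (e : M ≃ₗ[A] N) : ProjDimLT A N n :=
  h.of_retract e.symm e e.comp_symm

end ProjDimLT

section ShortExact

variable {f : K →ₗ[A] F} {g : F →ₗ[A] M} (hf : Function.Injective f) (hfg : Function.Exact f g)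
  (hg : Function.Surjective g)

include hf hfg hg

theorem shortExact_of_exact :
    (ShortComplex.mk (ModuleCat.ofHom f) (ModuleCat.ofHom g)
      (by rw [← ModuleCat.ofHom_comp, hfg.linearMap_comp_eq_zero]; rfl)).ShortExact where
  exact := (ShortComplex.ShortExact.moduleCat_exact_iff_function_exact _).2 hfg
  mono_f := (ModuleCat.mono_iff_injective _).2 hf
  epi_g := (ModuleCat.epi_iff_surjective _).2 hg

namespace ProjDimLT

theorem left {n : ℕ} (h₂ : ProjDimLT A F n) (h₃ : ProjDimLT A M (n + 1)) : ProjDimLT A K n :=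
  (shortExact_of_exact hf hfg hg).hasProjectiveDimensionLT_X₁ n h₂ h₃

theorem right {n : ℕ} (h₁ : ProjDimLT A K n) (h₂ : ProjDimLT A F (n + 1)) :
    ProjDimLT A M (n + 1) :=
  (shortExact_of_exact hf hfg hg).hasProjectiveDimensionLT_X₃ n h₁ h₂

theorem middle {n : ℕ} (h₁ : ProjDimLT A K n) (h₂ : ProjDimLT A M n) : ProjDimLT A F n :=
  (shortExact_of_exact hf hfg hg).hasProjectiveDimensionLT_X₂ n h₁ h₂

end ProjDimLT

theorem subsingleton_of_minimal_of_projective [Module.Projective A M] [Module.Finite A K]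
    {I : Ideal A} (hI : I ≤ Ideal.jacobson ⊥) (hmin : LinearMap.range f ≤ I • ⊤) :
    Subsingleton K := by
  have hsplit := Module.projective_lifting_property g LinearMap.id hg
  obtain ⟨-, r, hr⟩ := ((Function.Exact.split_tfae' hfg).out 0 1 rfl rfl).1 ⟨hf, hsplit⟩
  rw [← Submodule.subsingleton_iff A, ← subsingleton_iff_bot_eq_top, eq_comm]
  refine Submodule.eq_bot_of_le_smul_of_le_jacobson_bot I _ Module.Finite.fg_top ?_ hI
  calc (⊤ : Submodule A K) = (LinearMap.range f).map r := by
        rw [← LinearMap.range_comp, hr, LinearMap.range_id]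
    _ ≤ (I • ⊤ : Submodule A F).map r := Submodule.map_mono hmin
    _ ≤ I • ⊤ := by
        rw [Submodule.map_smul'']
        exact Submodule.smul_mono le_rfl le_top

theorem ProjDimLT.left_of_minimal [Module.Projective A F] [Module.Finite A K] {I : Ideal A}
    (hI : I ≤ Ideal.jacobson ⊥) (hmin : LinearMap.range f ≤ I • ⊤) {n : ℕ}
    (h : ProjDimLT A M (n + 1)) : ProjDimLT A K n := by
  cases n with
  | zero =>
    have := projDimLT_one_iff.1 h
    exact projDimLT_zero_iff.2 (subsingleton_of_minimal_of_projective hf hfg hg hI hmin)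
  | succ n => exact ProjDimLT.left hf hfg hg (.of_projective n) h

end ShortExact

namespace ProjDimLT

theorem of_ker {n : ℕ} {g : F →ₗ[A] M} (hg : Function.Surjective g)
    (h₁ : ProjDimLT A (LinearMap.ker g) n) (h₂ : ProjDimLT A F (n + 1)) : ProjDimLT A M (n + 1) :=
  .right Subtype.val_injective (LinearMap.exact_subtype_ker_map g) hg h₁ h₂

theorem ker [Module.Projective A F] {n : ℕ} {g : F →ₗ[A] M} (hg : Function.Surjective g)
    (h : ProjDimLT A M (n + 2)) : ProjDimLT A (LinearMap.ker g) (n + 1) :=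
  .left Subtype.val_injective (LinearMap.exact_subtype_ker_map g) hg (.of_projective n) h

theorem pi {n r : ℕ} (h : ProjDimLT A N n) : ProjDimLT A (Fin r → N) n := by
  induction r with
  | zero => exact (projDimLT_zero_iff.2 inferInstance).mono (Nat.zero_le n)
  | succ r ih =>
    have hprod : ProjDimLT A (N × (Fin r → N)) n :=
      .middle LinearMap.inl_injective Function.Exact.inl_snd LinearMap.snd_surjective h ih
    exact hprod.of_equiv (Fin.consLinearEquiv A fun _ => N)

theorem restrictScalars {B : Type u} [CommRing B] [IsNoetherianRing B] [Algebra A B] [Module B N]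
    [IsScalarTower A B N] [Module.Finite B N] {k n : ℕ} (hB : ProjDimLT A B (k + 1))
    (h : ProjDimLT B N n) : ProjDimLT A N (n + k) := by
  induction n generalizing N with
  | zero => exact (projDimLT_zero_iff.2 (projDimLT_zero_iff.1 h)).mono (Nat.zero_le _)
  | succ n ih =>
    obtain ⟨r, g, hg⟩ := Module.Finite.exists_fin' B N
    cases n with
    | zero =>
      have := projDimLT_one_iff.1 h
      obtain ⟨s, hs⟩ := Module.projective_lifting_property g LinearMap.id hg
      exact (hB.pi.of_retract (s.restrictScalars A) (g.restrictScalars A)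
        (LinearMap.ext fun y => LinearMap.congr_fun hs y)).mono (by omega)
    | succ n =>
      have hker : ProjDimLT A (LinearMap.ker g) (n + 1 + k) := ih (h.ker hg)
      exact (of_ker (g := g.restrictScalars A) hg hker (hB.pi.mono (by omega))).mono (by omega)

end ProjDimLT

theorem HasFiniteFreeResolution.exists_projDimLT (h : HasFiniteFreeResolution A M) :
    ∃ n, ProjDimLT A M n := by
  obtain ⟨n, r, d, ε, hr, hε, hd0, hd⟩ := h
  induction n generalizing M r with
  | zero =>
    have : Subsingleton (Fin (r (0 + 1)) → A) := by
      rw [hr _ (by omega)]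
      infer_instance
    exact ⟨1, .right (Function.injective_of_subsingleton (d 0)) hd0 hε
      (projDimLT_zero_iff.2 this) (.of_projective 0)⟩
  | succ n ih =>
    have hexact : Function.Exact (d 1) (d 0).rangeRestrict := fun x => by
      rw [← hd 0 x]
      exact Subtype.ext_iff
    obtain ⟨k, hk⟩ := ih (fun i => r (i + 1)) (fun i => d (i + 1)) (d 0).rangeRestrict
      (fun i hi => hr _ (by omega)) (d 0).surjective_rangeRestrict hexact fun i => hd (i + 1)
    rw [← hd0.linearMap_ker_eq] at hk
    exact ⟨k + 1, .of_ker hε hk (.of_projective k)⟩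

end ProjectiveDimension

/-! ### Regular local rings and Serre's theorem -/

section MinimalGenerators

theorem exists_fin_span_eq_top {R M : Type*} [CommRing R] [AddCommGroup M] [Module R M]
    [Module.Finite R M] {H : Set M} (hH : Submodule.span R H = ⊤) :
    ∃ (r : ℕ) (x : Fin r → M), (∀ i, x i ∈ H) ∧ Submodule.span R (Set.range x) = ⊤ := by
  obtain ⟨s, hsH, hs⟩ := (Submodule.fg_span_iff_fg_span_finset_subset H).1
    (hH ▸ Module.Finite.fg_top)
  refine ⟨s.card, fun i => s.equivFin.symm i, fun i => hsH (s.equivFin.symm i).2, ?_⟩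
  rw [← hH, hs]
  exact congrArg _ ((s.equivFin.symm.surjective.range_comp Subtype.val).trans Subtype.range_coe)

theorem exists_minimal_generators {R M : Type*} [CommRing R] [AddCommGroup M] [Module R M]
    [Module.Finite R M] {H : Set M} (hH : Submodule.span R H = ⊤) :
    ∃ (r : ℕ) (x : Fin r → M), (∀ i, x i ∈ H) ∧ Submodule.span R (Set.range x) = ⊤ ∧
      ∀ a : Fin r → R, ∑ i, a i • x i = 0 → ∀ i, ¬ IsUnit (a i) := by
  classical
  have h := exists_fin_span_eq_top hH
  obtain ⟨x, hx, hspan⟩ := Nat.find_spec h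
  refine ⟨Nat.find h, x, hx, hspan, fun a ha i hu => ?_⟩
  obtain ⟨r, hr⟩ : ∃ r, Nat.find h = r + 1 :=
    ⟨Nat.find h - 1, (Nat.succ_pred_eq_of_pos (Fin.pos i)).symm⟩
  have hmin : ¬ ∃ y : Fin r → M, (∀ i, y i ∈ H) ∧ Submodule.span R (Set.range y) = ⊤ :=
    Nat.find_min h (by omega)
  generalize Nat.find h = n at *
  subst hr
  refine hmin ⟨x ∘ i.succAbove, fun j => hx _, ?_⟩
  rw [eq_top_iff, ← hspan, Submodule.span_le]
  have hmem (l) : x (i.succAbove l) ∈ Submodule.span R (Set.range (x ∘ i.succAbove)) :=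
    Submodule.subset_span ⟨l, rfl⟩
  rintro _ ⟨j, rfl⟩
  rcases eq_or_ne j i with rfl | hj
  · rw [SetLike.mem_coe, ← Submodule.smul_mem_iff_of_isUnit _ hu]
    rw [Fin.sum_univ_succAbove _ j] at ha
    rw [eq_neg_of_add_eq_zero_left ha]
    exact neg_mem (sum_mem fun l _ => Submodule.smul_mem _ _ (hmem l))
  · obtain ⟨l, rfl⟩ := Fin.exists_succAbove_eq hj
    exact hmem l

end MinimalGenerators

section RegularLocalRing

open IsLocalRing TensorProduct

variable {A : Type u} [CommRing A] [IsLocalRing A]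

theorem isLocalRing_quotient_span_singleton {x : A} (hx : x ∈ maximalIdeal A) :
    IsLocalRing (A ⧸ Ideal.span {x}) := by
  have : Nontrivial (A ⧸ Ideal.span {x}) := Ideal.Quotient.nontrivial_iff.2 fun h =>
    (maximalIdeal.isMaximal A).ne_top
      (top_le_iff.1 (h ▸ (Ideal.span_singleton_le_iff_mem _).2 hx))
  exact .of_surjective' _ Ideal.Quotient.mk_surjective

theorem maximalIdeal_ne_bot_of_spanFinrank_eq_succ {n : ℕ}
    (h : (maximalIdeal A).spanFinrank = n + 1) : maximalIdeal A ≠ ⊥ := fun hbot => by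
  rw [hbot, Submodule.spanFinrank_bot] at h
  omega

theorem not_maximalIdeal_le_of_mem_minimalPrimes (hdim : ringKrullDim A ≠ 0) {p : Ideal A}
    (hp : p ∈ minimalPrimes A) : ¬ maximalIdeal A ≤ p := fun hle => by
  have := hp.1.1
  obtain rfl := (maximalIdeal.isMaximal A).eq_of_le this.ne_top hle
  rw [← maximalIdeal_height_eq_ringKrullDim, Ideal.height_eq_zero_iff.2 hp] at hdim
  exact hdim rfl

theorem exists_linearMap_residue_eq_tmul {x : A} (hx : x ∈ maximalIdeal A)
    [IsLocalRing (A ⧸ Ideal.span {x})] :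
    ∃ i : ResidueField (A ⧸ Ideal.span {x}) →ₗ[A ⧸ Ideal.span {x}]
      (A ⧸ Ideal.span {x}) ⊗[A] maximalIdeal A,
      ∀ b, i (residue _ b) = b ⊗ₜ ⟨x, hx⟩ := by
  let i := LinearMap.toSpanSingleton (A ⧸ Ideal.span {x}) _
    ((1 : A ⧸ Ideal.span {x}) ⊗ₜ[A] (⟨x, hx⟩ : maximalIdeal A))
  have hi (b) : i b = b ⊗ₜ ⟨x, hx⟩ := by
    rw [LinearMap.toSpanSingleton_apply, TensorProduct.smul_tmul', smul_eq_mul, mul_one]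
  refine ⟨Submodule.liftQ _ i fun b hb => ?_, hi⟩
  obtain ⟨a, rfl⟩ := Ideal.Quotient.mk_surjective b
  have ha : a ∈ maximalIdeal A := fun hu => hb (hu.map _)
  have hsmul (c : A) : Ideal.Quotient.mk (Ideal.span {x}) c = c • 1 := by
    rw [Algebra.smul_def, mul_one]
    rfl
  have hswap : a • (⟨x, hx⟩ : maximalIdeal A) = x • ⟨a, ha⟩ := Subtype.ext (mul_comm _ _)
  rw [LinearMap.mem_ker, hi, hsmul, TensorProduct.smul_tmul, hswap, ← TensorProduct.smul_tmul,
    ← hsmul, Ideal.Quotient.eq_zero_iff_mem.2 (Ideal.mem_span_singleton_self x),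
    TensorProduct.zero_tmul]

variable [IsNoetherianRing A]

theorem exists_mem_maximalIdeal_notMem_sq (hm : maximalIdeal A ≠ ⊥) {P : Set (Ideal A)}
    (hfin : P.Finite) (hP : ∀ p ∈ P, p.IsPrime) (hmP : ∀ p ∈ P, ¬ maximalIdeal A ≤ p) :
    ∃ x ∈ maximalIdeal A, x ∉ maximalIdeal A ^ 2 ∧ ∀ p ∈ P, x ∉ p := by
  classical
  have hsq : ¬ maximalIdeal A ≤ maximalIdeal A ^ 2 := fun hle => hm <|
    Submodule.eq_bot_of_le_smul_of_le_jacobson_bot (maximalIdeal A) _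
      (IsNoetherian.noetherian _) (by simpa [pow_two] using hle) (maximalIdeal_le_jacobson _)
  have havoid : ¬ (maximalIdeal A : Set A) ⊆
      ⋃ p ∈ (insert (maximalIdeal A ^ 2) hfin.toFinset : Finset (Ideal A)), (p : Set A) := by
    refine (Ideal.subset_union_prime (f := id) (maximalIdeal A ^ 2) (maximalIdeal A ^ 2)
      fun i hi hne _ => hP i (hfin.mem_toFinset.1
        ((Finset.mem_insert.1 hi).resolve_left hne))).not.2 ?_
    rintro ⟨p, hp, hle⟩
    rcases Finset.mem_insert.1 hp with rfl | hp
    · exact hsq hle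
    · exact hmP p (hfin.mem_toFinset.1 hp) hle
  obtain ⟨x, hx, hxn⟩ := Set.not_subset.1 havoid
  simp only [Finset.mem_insert, Set.Finite.mem_toFinset, Set.mem_iUnion, not_exists] at hxn
  exact ⟨x, hx, hxn _ (.inl rfl), fun p hp => hxn p (.inr hp)⟩

theorem exists_linearMap_residueField_eq_one {x : A} (hx : x ∈ maximalIdeal A)
    (hx2 : x ∉ maximalIdeal A ^ 2) :
    ∃ φ : maximalIdeal A →ₗ[A] ResidueField A, φ ⟨x, hx⟩ = 1 := by
  have h0 : (maximalIdeal A).toCotangent ⟨x, hx⟩ ≠ 0 := by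
    rwa [Ne, Ideal.toCotangent_eq_zero]
  obtain ⟨f, hf⟩ := not_forall.1 ((Module.forall_dual_apply_eq_zero_iff (ResidueField A)
    (V := CotangentSpace A) _).not.2 h0)
  exact ⟨((f _)⁻¹ • f).restrictScalars A ∘ₗ (maximalIdeal A).toCotangent, inv_mul_cancel₀ hf⟩

theorem exists_span_insert_eq_top_of_notMem_sq {x : maximalIdeal A}
    (hx2 : (x : A) ∉ maximalIdeal A ^ 2) :
    ∃ T : Set (maximalIdeal A), T.Finite ∧ T.ncard + 1 = (maximalIdeal A).spanFinrank ∧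
      Submodule.span A (insert x T) = ⊤ := by
  let π := (maximalIdeal A).toCotangent
  have hx0 : π x ≠ 0 := by rwa [Ne, Ideal.toCotangent_eq_zero]
  have hli : LinearIndepOn (ResidueField A) id ({π x} : Set (CotangentSpace A)) := .singleton hx0
  let S : Set (CotangentSpace A) := hli.extend (Set.subset_univ _)
  let b : Module.Basis S (ResidueField A) (CotangentSpace A) := .extend hli
  have hxS : π x ∈ S := hli.subset_extend _ rfl
  have hS : S.Finite := Module.Finite.finite_basis b
  obtain ⟨σ, hσ⟩ := (maximalIdeal A).toCotangent_surjective.hasRightInverse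
  refine ⟨σ '' (S \ {π x}), hS.sdiff.image σ, ?_, ?_⟩
  · rw [Set.ncard_image_of_injective _ hσ.injective, Set.ncard_sdiff_singleton_add_one hxS hS,
      spanFinrank_maximalIdeal_eq_finrank_cotangentSpace, Module.finrank_eq_nat_card_basis b]
    rfl
  · rw [← CotangentSpace.span_image_eq_top_iff, Set.image_insert_eq, Set.image_image,
      Set.image_congr fun v _ => hσ v, Set.image_id', Set.insert_sdiff_singleton,
      Set.insert_eq_of_mem hxS, ← b.span_eq, Module.Basis.range_extend]

theorem spanFinrank_maximalIdeal_add_one_le_of_surjective {B : Type*} [CommRing B] [IsLocalRing B]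
    {f : A →+* B} (hf : Function.Surjective f) {x : A} (hx : x ∈ maximalIdeal A)
    (hx2 : x ∉ maximalIdeal A ^ 2) (hfx : f x = 0) :
    (maximalIdeal B).spanFinrank + 1 ≤ (maximalIdeal A).spanFinrank := by
  obtain ⟨T, hT, hcard, hspan⟩ := exists_span_insert_eq_top_of_notMem_sq (x := ⟨x, hx⟩) hx2
  have hA : maximalIdeal A = Ideal.span (insert x (Subtype.val '' T)) := by
    have hmap := congrArg (Submodule.map (maximalIdeal A).subtype) hspan
    rw [Submodule.map_span, Submodule.map_subtype_top, Set.image_insert_eq] at hmap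
    exact hmap.symm
  have hB : maximalIdeal B = Submodule.span B (f '' (Subtype.val '' T)) := by
    refine (map_maximalIdeal_of_surjective f hf).symm.trans ((congrArg (Ideal.map f) hA).trans ?_)
    rw [Ideal.map_span, Set.image_insert_eq, hfx]
    exact Submodule.span_insert_zero
  have hfin := hT.image (Subtype.val : maximalIdeal A → A)
  rw [← hcard, hB]
  exact Nat.add_le_add_right ((Submodule.spanFinrank_span_le_ncard_of_finite (hfin.image f)).trans
    ((Set.ncard_image_le hfin).trans (Set.ncard_image_le hT))) 1

theorem spanFinrank_maximalIdeal_le_of_surjective {B : Type*} [CommRing B] [IsLocalRing B]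
    {f : A →+* B} (hf : Function.Surjective f) {x : A} (hx : RingHom.ker f = Ideal.span {x}) :
    (maximalIdeal A).spanFinrank ≤ (maximalIdeal B).spanFinrank + 1 := by
  classical
  have := isNoetherianRing_of_surjective A B f hf
  have := hf.isLocalHom
  obtain ⟨s, hs, hspan⟩ := Submodule.FG.exists_span_finset_card_eq_spanFinrank
    (IsNoetherian.noetherian (maximalIdeal B))
  obtain ⟨σ, hσ⟩ := hf.hasRightInverse
  have hmap : Ideal.map f (Ideal.span (σ '' s)) = maximalIdeal B := by
    rw [Ideal.map_span, Set.image_image, Set.image_congr fun b _ => hσ b, Set.image_id', ← hspan]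
  have hA : maximalIdeal A = Submodule.span A ((insert x (s.image σ) : Finset A) : Set A) := by
    rw [← maximalIdeal_comap f, ← hmap, Ideal.comap_map_of_surjective f hf,
      ← RingHom.ker_eq_comap_bot, hx, sup_comm, Finset.coe_insert, Finset.coe_image]
    exact (Submodule.span_insert _ _).symm
  rw [hA, ← hs]
  refine (Submodule.spanFinrank_span_le_ncard_of_finite (Finset.finite_toSet _)).trans ?_
  rw [Set.ncard_coe_finset]
  exact (Finset.card_insert_le _ _).trans (Nat.add_le_add_right Finset.card_image_le 1)

theorem spanFinrank_maximalIdeal_quotient_add_one {x : A} (hx : x ∈ maximalIdeal A)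
    (hx2 : x ∉ maximalIdeal A ^ 2) [IsLocalRing (A ⧸ Ideal.span {x})] :
    (maximalIdeal (A ⧸ Ideal.span {x})).spanFinrank + 1 = (maximalIdeal A).spanFinrank :=
  le_antisymm
    (spanFinrank_maximalIdeal_add_one_le_of_surjective Ideal.Quotient.mk_surjective hx hx2
      (Ideal.Quotient.eq_zero_iff_mem.2 (Ideal.mem_span_singleton_self x)))
    (spanFinrank_maximalIdeal_le_of_surjective Ideal.Quotient.mk_surjective Ideal.mk_ker)

theorem isRegularLocalRing_quotient_span_singleton {B : Type u} [CommRing B]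
    [IsRegularLocalRing B] {x : B} (hx : x ∈ maximalIdeal B) (hx2 : x ∉ maximalIdeal B ^ 2) :
    IsRegularLocalRing (B ⧸ Ideal.span {x}) := by
  have := isLocalRing_quotient_span_singleton hx
  refine .of_spanFinrank_maximalIdeal_le _ (ENat.WithBot.add_le_add_one_right_iff.1 ?_)
  have hdim := ringKrullDim_le_ringKrullDim_quotient_add_encard (R := B) {x}
    (by simpa [ringJacobson_eq_maximalIdeal] using hx)
  rw [Set.encard_singleton, ← IsRegularLocalRing.spanFinrank_maximalIdeal,
    ← spanFinrank_maximalIdeal_quotient_add_one hx hx2] at hdim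
  exact_mod_cast hdim

theorem isRegularLocalRing_of_quotient_span_singleton {x : A} (hx : x ∈ maximalIdeal A)
    (hx0 : x ∈ nonZeroDivisors A) [hreg : IsRegularLocalRing (A ⧸ Ideal.span {x})] :
    IsRegularLocalRing A := by
  refine .of_spanFinrank_maximalIdeal_le _ ?_
  rw [← ringKrullDim_quotient_span_singleton_succ_eq_ringKrullDim_of_mem_nonZeroDivisors hx0 hx,
    ← hreg.spanFinrank_maximalIdeal]
  exact_mod_cast spanFinrank_maximalIdeal_le_of_surjective
    (B := A ⧸ Ideal.span {x}) Ideal.Quotient.mk_surjective Ideal.mk_ker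

theorem eq_bot_of_le_span_singleton_of_notMem {p : Ideal A} [p.IsPrime] {x : A}
    (hx : x ∈ maximalIdeal A) (hle : p ≤ Ideal.span {x}) (hxp : x ∉ p) : p = ⊥ := by
  refine Submodule.eq_bot_of_le_smul_of_le_jacobson_bot (maximalIdeal A) _
    (IsNoetherian.noetherian _) (fun y hy => ?_) (maximalIdeal_le_jacobson _)
  obtain ⟨a, rfl⟩ := Ideal.mem_span_singleton'.1 (hle hy)
  rw [mul_comm]
  exact Submodule.smul_mem_smul hx ((Ideal.IsPrime.mem_or_mem ‹_› hy).resolve_right hxp)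

theorem isDomain_of_isRegularLocalRing (B : Type u) [CommRing B] [hB : IsRegularLocalRing B] :
    IsDomain B := by
  generalize hn : (maximalIdeal B).spanFinrank = n
  induction n generalizing B with
  | zero =>
    rw [Submodule.spanFinrank_eq_zero_iff_eq_bot (IsNoetherian.noetherian _)] at hn
    exact (isField_iff_maximalIdeal_eq.2 hn).isDomain
  | succ n ih =>
    have hdim : ringKrullDim B ≠ 0 := by
      rw [← hB.spanFinrank_maximalIdeal, hn]
      exact_mod_cast n.succ_ne_zero
    obtain ⟨x, hx, hx2, hxP⟩ := exists_mem_maximalIdeal_notMem_sq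
      (maximalIdeal_ne_bot_of_spanFinrank_eq_succ hn) (minimalPrimes.finite_of_isNoetherianRing B)
      (fun p hp => hp.1.1) fun p hp => not_maximalIdeal_le_of_mem_minimalPrimes hdim hp
    have := isRegularLocalRing_quotient_span_singleton hx hx2
    have hprime : (Ideal.span {x}).IsPrime := (Ideal.Quotient.isDomain_iff_prime _).1 <|
      ih (B ⧸ Ideal.span {x}) (by have := spanFinrank_maximalIdeal_quotient_add_one hx hx2; omega)
    obtain ⟨p, hp, hpx⟩ := Ideal.exists_minimalPrimes_le (bot_le (a := Ideal.span {x}))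
    have := hp.1.1
    obtain rfl := eq_bot_of_le_span_singleton_of_notMem hx hpx (hxP p hp)
    exact IsDomain.of_bot_isPrime B

section FiniteProjectiveDimension

variable {M : Type u} [AddCommGroup M] [Module A M] [Module.Finite A M]

theorem ProjDimLT.of_quotSMulTop {x : A} (hreg : IsSMulRegular M x) (hx : x ∈ maximalIdeal A)
    {n : ℕ} (h : ProjDimLT A (QuotSMulTop x M) n) : ProjDimLT A M n := by
  rw [ProjDimLT, ← projectiveDimension_lt_iff] at h ⊢
  rw [ModuleCat.projectiveDimension_quotSMulTop_eq_succ_of_isSMulRegular (.of A M) x hreg hx] at h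
  exact lt_of_le_of_lt (le_add_of_nonneg_right zero_le_one) h

theorem projDimLT_quotient_span_singleton {A : Type u} [CommRing A] [IsDomain A] {x : A}
    (hx0 : x ≠ 0) : ProjDimLT A (A ⧸ Ideal.span {x}) 2 := by
  refine .right (f := LinearMap.lsmul A A x) (g := (Ideal.span {x}).mkQ) (mul_right_injective₀ hx0)
    (fun a => ?_) (Submodule.mkQ_surjective _) (.of_projective 0) (.of_projective 1)
  rw [Submodule.mkQ_apply, Submodule.Quotient.mk_eq_zero, Ideal.mem_span_singleton']
  exact exists_congr fun b => by rw [mul_comm]; rfl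

theorem exists_projDimLT_of_isRegularLocalRing (A : Type u) [CommRing A] [IsRegularLocalRing A]
    (M : Type u) [AddCommGroup M] [Module A M] [Module.Finite A M] : ∃ n, ProjDimLT A M n := by
  generalize hn : (maximalIdeal A).spanFinrank = n
  induction n generalizing A M with
  | zero =>
    rw [Submodule.spanFinrank_eq_zero_iff_eq_bot (IsNoetherian.noetherian _)] at hn
    let _ := (isField_iff_maximalIdeal_eq.2 hn).toField
    exact ⟨1, .of_projective 0⟩
  | succ n ih =>
    have := isDomain_of_isRegularLocalRing A
    obtain ⟨x, hx, hx2, -⟩ := exists_mem_maximalIdeal_notMem_sq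
      (maximalIdeal_ne_bot_of_spanFinrank_eq_succ hn) Set.finite_empty (by simp) (by simp)
    have hx0 : x ≠ 0 := fun h => hx2 (h ▸ zero_mem _)
    have := isRegularLocalRing_quotient_span_singleton hx hx2
    obtain ⟨r, g, hg⟩ := Module.Finite.exists_fin' A M
    have hreg : IsSMulRegular (LinearMap.ker g) x := .of_ne_zero hx0
    have := Module.Finite.of_restrictScalars_finite A (A ⧸ Ideal.span {x})
      (QuotSMulTop x (LinearMap.ker g))
    obtain ⟨k, hk⟩ := ih (A ⧸ Ideal.span {x}) (QuotSMulTop x (LinearMap.ker g))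
      (by have := spanFinrank_maximalIdeal_quotient_add_one hx hx2; omega)
    have hker := ProjDimLT.of_quotSMulTop hreg hx
      ((projDimLT_quotient_span_singleton hx0).restrictScalars hk)
    exact ⟨_, .of_ker hg hker (.of_projective _)⟩

theorem exists_surjective_pi_ker_le_smul_top (A : Type u) [CommRing A] [IsLocalRing A]
    (M : Type u) [AddCommGroup M] [Module A M] [Module.Finite A M] :
    ∃ (r : ℕ) (g : (Fin r → A) →ₗ[A] M), Function.Surjective g ∧
      LinearMap.ker g ≤ maximalIdeal A • ⊤ := by
  obtain ⟨r, x, -, hspan, hmin⟩ := exists_minimal_generators (Submodule.span_univ (R := A) (M := M))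
  refine ⟨r, Fintype.linearCombination A x, ?_, fun a ha => ?_⟩
  · rw [← LinearMap.range_eq_top, Fintype.range_linearCombination, hspan]
  · rw [LinearMap.mem_ker, Fintype.linearCombination_apply] at ha
    rw [← (Pi.basisFun A (Fin r)).sum_repr a]
    exact sum_mem fun i _ => Submodule.smul_mem_smul (hmin a ha i) trivial

theorem free_of_projDimLT {s : A} (hs : s ≠ 0) (hsm : ∀ a ∈ maximalIdeal A, a * s = 0) {n : ℕ}
    (h : ProjDimLT A M n) : Module.Free A M := by
  induction n generalizing M with
  | zero =>
    rw [projDimLT_zero_iff] at h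
    infer_instance
  | succ n ih =>
    obtain ⟨r, g, hg, hmin⟩ := exists_surjective_pi_ker_le_smul_top A M
    have hfree : Module.Free A (LinearMap.ker g) := ih <| .left_of_minimal
      (LinearMap.ker g).subtype_injective (LinearMap.exact_subtype_ker_map g) hg
      (maximalIdeal_le_jacobson _) (by rwa [Submodule.range_subtype]) h
    have hs0 : LinearMap.ker g ≤ Submodule.torsionBy A (Fin r → A) s :=
      hmin.trans <| Submodule.smul_le.2 fun a ha y _ => by
        rw [Submodule.mem_torsionBy_iff, smul_smul, mul_comm, hsm a ha, zero_smul]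
    have hker : LinearMap.ker g = ⊥ := by
      by_contra hne
      have := Submodule.nontrivial_iff_ne_bot.2 hne
      have hann : s ∈ Module.annihilator A (LinearMap.ker g) :=
        Module.mem_annihilator.2 fun y => Subtype.ext (hs0 y.2)
      rw [Module.annihilator_eq_bot.2 inferInstance] at hann
      exact hs hann
    exact .of_equiv (LinearEquiv.ofBijective g ⟨LinearMap.ker_eq_bot.1 hker, hg⟩)

theorem injective_baseChange_quotient {A K F M : Type*} [CommRing A] [AddCommGroup K] [Module A K]
    [AddCommGroup F] [Module A F] [AddCommGroup M] [Module A M] {x : A} {f : K →ₗ[A] F}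
    {g : F →ₗ[A] M} (hf : Function.Injective f) (hfg : Function.Exact f g)
    (hxM : IsSMulRegular M x) : Function.Injective (f.baseChange (A ⧸ Ideal.span {x})) := by
  have hex := QuotSMulTop.map_first_exact_on_four_term_exact_of_isSMulRegular_last
    ((LinearMap.exact_zero_iff_injective PUnit f).2 hf) hfg hxM
  rw [map_zero, LinearMap.exact_zero_iff_injective] at hex
  have hnat := QuotSMulTop.equivQuotTensor_naturality x f
  have hcomp := (QuotSMulTop.equivQuotTensor x F).injective.comp hex
  rw [← LinearEquiv.coe_toLinearMap, ← LinearMap.coe_comp, hnat, LinearMap.coe_comp] at hcomp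
  exact ((QuotSMulTop.equivQuotTensor x K).toEquiv.injective_comp _).1 hcomp

theorem ProjDimLT.quotient_tensor {A M : Type u} [CommRing A] [AddCommGroup M] [Module A M] {x : A}
    (hx : IsSMulRegular A x) (hxM : IsSMulRegular M x) {n : ℕ} (h : ProjDimLT A M n) :
    ProjDimLT (A ⧸ Ideal.span {x}) ((A ⧸ Ideal.span {x}) ⊗[A] M) n := by
  induction n generalizing M with
  | zero =>
    rw [projDimLT_zero_iff] at h ⊢
    infer_instance
  | succ n ih =>
    rcases n with _ | n
    · rw [zero_add, projDimLT_one_iff] at h ⊢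
      infer_instance
    · let g : (M →₀ A) →ₗ[A] M := Finsupp.linearCombination A id
      have hg : Function.Surjective g := Finsupp.linearCombination_id_surjective A M
      have hregF : IsSMulRegular (M →₀ A) x := fun a b hab =>
        Finsupp.ext fun i => hx (DFunLike.congr_fun hab i)
      have hregK : IsSMulRegular (LinearMap.ker g) x := fun a b hab => Subtype.ext
        (hregF (congrArg Subtype.val hab))
      have hex := LinearMap.exact_subtype_ker_map g
      exact .right (g := g.baseChange (A ⧸ Ideal.span {x}))
        (injective_baseChange_quotient (LinearMap.ker g).subtype_injective hex hxM)
        (lTensor_exact _ hex hg) (LinearMap.lTensor_surjective _ hg)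
        (ih hregK (.ker hg h)) (.of_projective _)

theorem exists_nonZeroDivisor_of_projDimLT_residueField {n : ℕ}
    (h : ProjDimLT A (ResidueField A) n) (hm : maximalIdeal A ≠ ⊥) :
    ∃ x ∈ maximalIdeal A, x ∉ maximalIdeal A ^ 2 ∧ x ∈ nonZeroDivisors A := by
  have hprime (p) (hp : p ∈ associatedPrimes A A) := isAssociatedPrime_iff.1 hp
  have hle (p) (hp : p ∈ associatedPrimes A A) : ¬ maximalIdeal A ≤ p := fun hle => by
    obtain ⟨hprime, s, rfl⟩ := hprime p hp
    have hs : s ≠ 0 := by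
      rintro rfl
      exact hprime.ne_top (by simp)
    have := free_of_projDimLT hs (fun a ha => by simpa using hle ha) h
    exact hm (eq_bot_iff.2 fun a ha => FaithfulSMul.algebraMap_injective A (ResidueField A)
      (((residue_eq_zero_iff a).2 ha).trans (map_zero _).symm))
  obtain ⟨x, hx, hx2, hxP⟩ := exists_mem_maximalIdeal_notMem_sq hm (associatedPrimes.finite A A)
    (fun p hp => (hprime p hp).1) hle
  refine ⟨x, hx, hx2, not_not.1 fun hx0 => ?_⟩
  have hmem : x ∈ (nonZeroDivisors A : Set A)ᶜ := hx0
  rw [← biUnion_associatedPrimes_eq_compl_nonZeroDivisors] at hmem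
  obtain ⟨p, hp, hxp⟩ := Set.mem_iUnion₂.1 hmem
  exact hxP p hp hxp

theorem exists_linearMap_tensor_residueField_eq_one {x : A} (hx : x ∈ maximalIdeal A)
    [IsLocalRing (A ⧸ Ideal.span {x})] (hx2 : x ∉ maximalIdeal A ^ 2) :
    ∃ ρ : (A ⧸ Ideal.span {x}) ⊗[A] maximalIdeal A →ₗ[A ⧸ Ideal.span {x}]
      ResidueField (A ⧸ Ideal.span {x}), ρ (1 ⊗ₜ ⟨x, hx⟩) = 1 := by
  obtain ⟨φ, hφ⟩ := exists_linearMap_residueField_eq_one hx hx2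
  have : IsLocalHom (algebraMap A (A ⧸ Ideal.span {x})) :=
    Ideal.Quotient.mk_surjective.isLocalHom
  let ψ : ResidueField A →ₗ[A] ResidueField (A ⧸ Ideal.span {x}) :=
    (Algebra.linearMap (ResidueField A) _).restrictScalars A
  refine ⟨LinearMap.liftBaseChange _ (ψ ∘ₗ φ), ?_⟩
  rw [LinearMap.liftBaseChange_tmul, LinearMap.comp_apply, hφ, one_smul]
  exact map_one (algebraMap (ResidueField A) (ResidueField (A ⧸ Ideal.span {x})))

theorem ProjDimLT.residueField_quotient {n : ℕ} (h : ProjDimLT A (ResidueField A) n)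
    {x : A} (hx : x ∈ maximalIdeal A) (hx2 : x ∉ maximalIdeal A ^ 2)
    (hx0 : x ∈ nonZeroDivisors A) [IsLocalRing (A ⧸ Ideal.span {x})] :
    ProjDimLT (A ⧸ Ideal.span {x}) (ResidueField (A ⧸ Ideal.span {x})) (n + 1) := by
  have hreg : IsSMulRegular A x := fun a b hab => (mul_cancel_left_mem_nonZeroDivisors hx0).1 hab
  have hregm : IsSMulRegular (maximalIdeal A) x := fun a b hab => Subtype.ext
    (hreg (congrArg Subtype.val hab))
  have hm : ProjDimLT A (maximalIdeal A) (n + 1) :=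
    .left (maximalIdeal A).subtype_injective (LinearMap.exact_subtype_mkQ _)
      (Submodule.mkQ_surjective _) (.of_projective _) (h.mono (by omega))
  obtain ⟨i, hi⟩ := exists_linearMap_residue_eq_tmul hx
  obtain ⟨ρ, hρ⟩ := exists_linearMap_tensor_residueField_eq_one hx hx2
  refine (hm.quotient_tensor hreg hregm).of_retract i ρ (LinearMap.ext fun y => ?_)
  obtain ⟨b, rfl⟩ := residue_surjective y
  have hb : b ⊗ₜ[A] (⟨x, hx⟩ : maximalIdeal A) = b • (1 ⊗ₜ ⟨x, hx⟩) := by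
    rw [TensorProduct.smul_tmul', smul_eq_mul, mul_one]
  rw [LinearMap.comp_apply, hi, hb, map_smul, hρ, Algebra.smul_def, mul_one]
  rfl

theorem isRegularLocalRing_of_projDimLT_residueField (A : Type u) [CommRing A] [IsLocalRing A]
    [IsNoetherianRing A] {n : ℕ} (h : ProjDimLT A (ResidueField A) n) : IsRegularLocalRing A := by
  generalize hd : (maximalIdeal A).spanFinrank = d
  induction d generalizing A n with
  | zero =>
    rw [Submodule.spanFinrank_eq_zero_iff_eq_bot (IsNoetherian.noetherian _)] at hd
    let _ := (isField_iff_maximalIdeal_eq.2 hd).toField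
    infer_instance
  | succ d ih =>
    obtain ⟨x, hx, hx2, hx0⟩ := exists_nonZeroDivisor_of_projDimLT_residueField h
      (maximalIdeal_ne_bot_of_spanFinrank_eq_succ hd)
    have := isLocalRing_quotient_span_singleton hx
    have hreg := ih _ (h.residueField_quotient hx hx2 hx0)
      (by have := spanFinrank_maximalIdeal_quotient_add_one hx hx2; omega)
    exact isRegularLocalRing_of_quotient_span_singleton hx hx0

end FiniteProjectiveDimension

end RegularLocalRing

/-! ### Graded modules -/

theorem isInternal_of_proj {ι X : Type*} [DecidableEq ι] [AddCommGroup X] {G : ι → AddSubgroup X}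
    (p : ι → X →+ X) (h₁ : ∀ n, ∀ x ∈ G n, p n x = x)
    (h₂ : ∀ m n, m ≠ n → ∀ x ∈ G m, p n x = 0) (h₃ : ∀ x, x ∈ ⨆ n, G n) :
    DirectSum.IsInternal G := by
  constructor
  · have hcoord (y : DirectSum ι fun n => G n) (n) : p n (DirectSum.coeAddMonoidHom G y) = y n := by
      induction y using DirectSum.induction_on with
      | zero => simp
      | of i x =>
        rw [DirectSum.coeAddMonoidHom_of]
        by_cases h : i = n
        · subst h
          rw [DirectSum.of_eq_same, h₁ _ _ x.2]
        · rw [DirectSum.of_eq_of_ne _ _ _ (Ne.symm h), h₂ _ _ h _ x.2]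
          rfl
      | add x y hx hy => rw [map_add, map_add, hx, hy, DirectSum.add_apply, AddSubgroup.coe_add]
    intro y z hyz
    exact DFinsupp.ext fun n => Subtype.ext (by rw [← hcoord, ← hcoord, hyz])
  · have h : ⨆ n, G n ≤ (DirectSum.coeAddMonoidHom G).range :=
      iSup_le fun n x hx => ⟨DirectSum.of _ n ⟨x, hx⟩, DirectSum.coeAddMonoidHom_of _ _ _⟩
    exact fun x => h (h₃ x)

namespace GrMod

variable {R : Type u} [CommRing R] {𝒜 : ℤ → AddSubgroup R}

/-- The projection of a graded module to its component of degree `n`. -/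
noncomputable def proj (M : GrMod 𝒜) (n : ℤ) : M.carrier →+ M.carrier :=
  (M.grading n).subtype.comp ((DFinsupp.evalAddMonoidHom n).comp
    (AddEquiv.ofBijective _ M.isInternal).symm.toAddMonoidHom)

variable {M N : GrMod 𝒜}

theorem proj_mem (n : ℤ) (x : M.carrier) : M.proj n x ∈ M.grading n := SetLike.coe_mem _

theorem proj_coeAddMonoidHom (n : ℤ) (y : DirectSum ℤ fun n => M.grading n) :
    M.proj n (DirectSum.coeAddMonoidHom M.grading y) = y n :=
  congrArg (fun z : DirectSum ℤ fun n => M.grading n => (z n : M.carrier))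
    ((AddEquiv.ofBijective _ M.isInternal).symm_apply_apply y)

theorem proj_of_mem {n : ℤ} {x : M.carrier} (hx : x ∈ M.grading n) : M.proj n x = x := by
  classical
  have := proj_coeAddMonoidHom n (DirectSum.of (fun n => M.grading n) n ⟨x, hx⟩)
  rwa [DirectSum.coeAddMonoidHom_of, DirectSum.of_eq_same] at this

theorem proj_of_mem_ne {m n : ℤ} (h : m ≠ n) {x : M.carrier} (hx : x ∈ M.grading m) :
    M.proj n x = 0 := by
  classical
  have := proj_coeAddMonoidHom n (DirectSum.of (fun n => M.grading n) m ⟨x, hx⟩)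
  rwa [DirectSum.coeAddMonoidHom_of, DirectSum.of_eq_of_ne _ _ _ (Ne.symm h)] at this

theorem mem_of_proj_mem (H : AddSubgroup M.carrier) {x : M.carrier}
    (h : ∀ n, M.proj n x ∈ H) : x ∈ H := by
  classical
  obtain ⟨y, rfl⟩ := M.isInternal.2 x
  simp only [proj_coeAddMonoidHom] at h
  rw [← DirectSum.sum_support_of y, map_sum]
  exact sum_mem fun n _ => by rw [DirectSum.coeAddMonoidHom_of]; exact h n

@[elab_as_elim]
theorem induction {p : M.carrier → Prop} (x : M.carrier) (zero : p 0)
    (add : ∀ x y, p x → p y → p (x + y)) (hom : ∀ n, ∀ x ∈ M.grading n, p x) : p x := by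
  classical
  obtain ⟨y, rfl⟩ := M.isInternal.2 x
  induction y using DirectSum.induction_on with
  | zero => rwa [map_zero]
  | of n x => rw [DirectSum.coeAddMonoidHom_of]; exact hom n x x.2
  | add x y hx hy => rw [map_add]; exact add _ _ hx hy

theorem map_proj {f : M.carrier →+ N.carrier} {k : ℤ}
    (hf : ∀ n, ∀ x ∈ M.grading n, f x ∈ N.grading (n + k)) (n : ℤ) (x : M.carrier) :
    f (M.proj n x) = N.proj (n + k) (f x) := by
  induction x using GrMod.induction with
  | zero => simp
  | add x y hx hy => simp only [map_add, hx, hy]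
  | hom m x hx =>
    by_cases h : m = n
    · subst h
      rw [proj_of_mem hx, proj_of_mem (hf _ _ hx)]
    · rw [proj_of_mem_ne h hx, proj_of_mem_ne (by omega) (hf _ _ hx), map_zero]

/-- A submodule stable under the projections is a graded module. -/
noncomputable abbrev ofSubmodule (M : GrMod 𝒜) (p : Submodule R M.carrier)
    (hp : ∀ n, ∀ x ∈ p, M.proj n x ∈ p) : GrMod 𝒜 where
  carrier := p
  grading n := (M.grading n).comap p.subtype.toAddMonoidHom
  isInternal := by
    refine isInternal_of_proj
      (fun n => ((M.proj n).comp p.subtype.toAddMonoidHom).codRestrict p fun x => hp n _ x.2)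
      (fun n x hx => Subtype.ext (proj_of_mem hx))
      (fun m n h x hx => Subtype.ext (proj_of_mem_ne h hx)) fun x => ?_
    have hx : (x : M.carrier) ∈ (⨆ n, (M.grading n).comap p.subtype.toAddMonoidHom).map
        p.subtype.toAddMonoidHom := mem_of_proj_mem _ fun n =>
      ⟨⟨_, hp n x x.2⟩, AddSubgroup.mem_iSup_of_mem n (proj_mem n _), rfl⟩
    obtain ⟨y, hy, hxy⟩ := hx
    rwa [← Subtype.ext hxy]
  smul_mem hr hx := M.smul_mem hr hx

theorem proj_ofSubmodule (p : Submodule R M.carrier) (hp : ∀ n, ∀ x ∈ p, M.proj n x ∈ p) (n : ℤ)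
    (x : p) : (((M.ofSubmodule p hp).proj n x : p) : M.carrier) = M.proj n x := by
  have := map_proj (M := M.ofSubmodule p hp) (N := M) (f := p.subtype.toAddMonoidHom) (k := 0)
    (fun n x hx => (add_zero n).symm ▸ hx) n x
  rwa [add_zero] at this

/-- The shift of a graded module: an element of degree `n` has degree `n + k` in the shift. -/
abbrev shift (M : GrMod 𝒜) (k : ℤ) : GrMod 𝒜 where
  carrier := M.carrier
  grading n := M.grading (n - k)
  isInternal := isInternal_of_proj (fun n => M.proj (n - k))
    (fun _ _ hx => proj_of_mem hx) (fun _ _ h _ hx => proj_of_mem_ne (by omega) hx) fun x => by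
      induction x using GrMod.induction with
      | zero => exact zero_mem _
      | add x y hx hy => exact add_mem hx hy
      | hom n x hx => exact AddSubgroup.mem_iSup_of_mem (n + k) (by rwa [add_sub_cancel_right])
  smul_mem {i j r x} hr hx := by
    rw [add_sub_assoc]
    exact M.smul_mem hr hx

/-- The product of two graded modules. -/
abbrev prod (M N : GrMod 𝒜) : GrMod 𝒜 where
  carrier := M.carrier × N.carrier
  grading n := (M.grading n).prod (N.grading n)
  isInternal := isInternal_of_proj (fun n => (M.proj n).prodMap (N.proj n))
    (fun _ _ hx => Prod.ext (proj_of_mem hx.1) (proj_of_mem hx.2))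
    (fun _ _ h _ hx => Prod.ext (proj_of_mem_ne h hx.1) (proj_of_mem_ne h hx.2)) fun x => by
      obtain ⟨x, y⟩ := x
      have hx : (x, (0 : N.carrier)) ∈ ⨆ n, (M.grading n).prod (N.grading n) := by
        induction x using GrMod.induction with
        | zero => exact zero_mem _
        | add x y hx hy => simpa using add_mem hx hy
        | hom n x hx => exact AddSubgroup.mem_iSup_of_mem n ⟨hx, zero_mem _⟩
      have hy : ((0 : M.carrier), y) ∈ ⨆ n, (M.grading n).prod (N.grading n) := by
        induction y using GrMod.induction with
        | zero => exact zero_mem _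
        | add x y hx hy => simpa using add_mem hx hy
        | hom n x hx => exact AddSubgroup.mem_iSup_of_mem n ⟨zero_mem _, hx⟩
      simpa using add_mem hx hy
  smul_mem hr hx := ⟨M.smul_mem hr hx.1, N.smul_mem hr hx.2⟩

theorem span_homogeneous (M : GrMod 𝒜) :
    Submodule.span R {z : M.carrier | ∃ n, z ∈ M.grading n} = ⊤ :=
  eq_top_iff.2 fun x _ => by
    induction x using GrMod.induction with
    | zero => exact zero_mem _
    | add x y hx hy => exact add_mem (hx trivial) (hy trivial)
    | hom n x hx => exact Submodule.subset_span ⟨n, hx⟩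

variable [GradedRing 𝒜]

variable (𝒜) in
/-- The ring as a graded module over itself. -/
abbrev ring : GrMod 𝒜 where
  carrier := R
  grading := 𝒜
  isInternal := DirectSum.Decomposition.isInternal 𝒜
  smul_mem hr hx := SetLike.mul_mem_graded hr hx

variable (𝒜) in
/-- The free graded module on generators of prescribed degrees. -/
abbrev free {r : ℕ} (deg : Fin r → ℤ) : GrMod 𝒜 where
  carrier := Fin r → R
  grading n := AddSubgroup.pi Set.univ fun i => 𝒜 (n - deg i)
  isInternal := isInternal_of_proj
    (fun n => AddMonoidHom.pi fun i => ((ring 𝒜).proj (n - deg i)).comp (Pi.evalAddMonoidHom _ i))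
    (fun n x hx => funext fun i => proj_of_mem (M := ring 𝒜) (hx i trivial))
    (fun m n h x hx => funext fun i => proj_of_mem_ne (M := ring 𝒜) (by omega) (hx i trivial))
    fun x => by
      classical
      rw [← Finset.univ_sum_single x]
      refine sum_mem fun i _ => ?_
      generalize x i = a
      induction a using GrMod.induction (M := ring 𝒜) with
      | zero => simp
      | add a b ha hb => rw [Pi.single_add]; exact add_mem ha hb
      | hom n a ha =>
        refine AddSubgroup.mem_iSup_of_mem (n + deg i) fun j _ => ?_
        by_cases h : j = i
        · subst h
          simpa using ha
        · simp [h]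
  smul_mem {i j r x} hr hx l _ := by
    change r * x l ∈ 𝒜 (i + j - deg l)
    rw [add_sub_assoc]
    exact SetLike.mul_mem_graded hr (hx l trivial)

theorem single_mem_free {r : ℕ} (deg : Fin r → ℤ) (i : Fin r) :
    (Pi.single i 1 : Fin r → R) ∈ (free 𝒜 deg).grading (deg i) := by
  intro j _
  by_cases h : j = i
  · subst h
    simpa using SetLike.GradedOne.one_mem
  · simp [h]

theorem isFiniteFree_free {r : ℕ} (deg : Fin r → ℤ) : (free 𝒜 deg).IsFiniteFree :=
  ⟨r, Pi.basisFun R (Fin r), fun i => ⟨deg i, by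
    rw [Pi.basisFun_apply]
    exact single_mem_free deg i⟩⟩

/-- The homomorphism from a free graded module sending the generators to given elements of the
right degrees. -/
noncomputable def freeHom {r : ℕ} {deg : Fin r → ℤ} {z : Fin r → M.carrier}
    (hz : ∀ i, z i ∈ M.grading (deg i)) : Hom (free 𝒜 deg) M where
  toLinearMap := Fintype.linearCombination R z
  map_mem {n x} hx := by
    rw [Fintype.linearCombination_apply]
    exact sum_mem fun i _ => sub_add_cancel n (deg i) ▸ M.smul_mem (hx i trivial) (hz i)

theorem mem_of_not_isUnit (m : HomogeneousIdeal 𝒜) [hm : IsLocalGraded 𝒜 m] {i : ℤ} {r : R}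
    (hr : r ∈ 𝒜 i) (hu : ¬ IsUnit r) : r ∈ m.toIdeal :=
  hm.le_of_ne_top ⟨Ideal.span {r}, Ideal.homogeneous_span 𝒜 _ (by simpa using ⟨i, hr⟩)⟩
    (by rwa [Ne, Ideal.span_singleton_eq_top]) (Ideal.mem_span_singleton_self r)

theorem proj_smul_of_mem {k : ℤ} {z : M.carrier} (hz : z ∈ M.grading k) (n : ℤ) (a : R) :
    M.proj (n + k) (a • z) = (ring 𝒜).proj n a • z :=
  (map_proj (M := ring 𝒜) (N := M) (f := (LinearMap.toSpanSingleton R M.carrier z).toAddMonoidHom)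
    (fun _ _ hx => M.smul_mem hx hz) n a).symm

theorem exists_minimal_generators (m : HomogeneousIdeal 𝒜) [IsLocalGraded 𝒜 m] {N : Type*}
    [AddCommGroup N] [Module R N] [Module.Finite R N] (π : M.carrier →ₗ[R] N)
    (hπ : Function.Surjective π) (hker : ∀ x, π x = 0 → ∀ n, π (M.proj n x) = 0) :
    ∃ (r : ℕ) (deg : Fin r → ℤ) (z : Fin r → M.carrier), (∀ i, z i ∈ M.grading (deg i)) ∧
      Submodule.span R (Set.range fun i => π (z i)) = ⊤ ∧
      ∀ a : Fin r → R, ∑ i, a i • π (z i) = 0 → ∀ i, a i ∈ m.toIdeal := by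
  have hspan : Submodule.span R (π '' {z | ∃ n, z ∈ M.grading n}) = ⊤ := by
    rw [Submodule.span_image, span_homogeneous, Submodule.map_top, LinearMap.range_eq_top.2 hπ]
  obtain ⟨r, y, hy, hspan, hmin⟩ := _root_.exists_minimal_generators hspan
  choose z hz hzy using hy
  choose deg hdeg using hz
  obtain rfl : (fun i => π (z i)) = y := funext hzy
  refine ⟨r, deg, z, hdeg, hspan, fun a ha i => ?_⟩
  refine mem_of_proj_mem (M := ring 𝒜) m.toIdeal.toAddSubgroup fun j => ?_
  -- The part of degree `j + deg i` of the relation has the components of degree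
  -- `j + deg i - deg l` of the `a l` as coefficients.
  have hrel : ∑ l, (ring 𝒜).proj (j + deg i - deg l) (a l) • π (z l) = 0 := by
    rw [← hker (∑ l, a l • z l) (by simpa using ha) (j + deg i), map_sum, map_sum]
    refine Finset.sum_congr rfl fun l _ => ?_
    rw [← map_smul, ← proj_smul_of_mem (hdeg l), sub_add_cancel]
  refine mem_of_not_isUnit m (proj_mem (M := ring 𝒜) j (a i)) ?_
  simpa using hmin _ hrel i

end GrMod

/-! ### Differential graded modules -/

namespace DGMod

variable {R : Type u} [CommRing R] {𝒜 : ℤ → AddSubgroup R} {M N P X Y : DGMod 𝒜}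

theorem quasiIso_iff (f : M ⟶ N) : quasiIso 𝒜 f ↔
    (∀ z, N.d z = 0 → ∃ x, M.d x = 0 ∧ ∃ w, Hom.toLinearMap f x = z + N.d w) ∧
      ∀ x, M.d x = 0 → ∀ w, Hom.toLinearMap f x = N.d w → ∃ y, M.d y = x := by
  constructor
  · rintro ⟨hinj, hsurj⟩
    constructor
    · intro z hz
      obtain ⟨x, hx⟩ := hsurj (Submodule.Quotient.mk ⟨z, hz⟩)
      obtain ⟨x, rfl⟩ := Submodule.Quotient.mk_surjective _ x
      obtain ⟨w, hw⟩ := (Submodule.Quotient.eq _).1 hx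
      exact ⟨x, x.2, w, (sub_eq_iff_eq_add'.1 hw.symm)⟩
    · intro x hx w hw
      have h0 : homologyMap f (Submodule.Quotient.mk ⟨x, hx⟩) = 0 :=
        (Submodule.Quotient.mk_eq_zero _).2 ⟨w, hw.symm⟩
      obtain ⟨y, hy⟩ := (Submodule.Quotient.mk_eq_zero _).1
        (hinj (h0.trans (map_zero _).symm))
      exact ⟨y, hy⟩
  · rintro ⟨hsurj, hinj⟩
    constructor
    · rw [injective_iff_map_eq_zero]
      intro x hx
      obtain ⟨x, rfl⟩ := Submodule.Quotient.mk_surjective _ x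
      obtain ⟨w, hw⟩ := (Submodule.Quotient.mk_eq_zero _).1 hx
      obtain ⟨y, hy⟩ := hinj x x.2 w hw.symm
      exact (Submodule.Quotient.mk_eq_zero _).2 ⟨y, hy⟩
    · intro z
      obtain ⟨z, rfl⟩ := Submodule.Quotient.mk_surjective _ z
      obtain ⟨x, hx, w, hw⟩ := hsurj z z.2
      exact ⟨Submodule.Quotient.mk ⟨x, hx⟩,
        (Submodule.Quotient.eq _).2 ⟨w, (sub_eq_iff_eq_add'.2 hw).symm⟩⟩

/-- A DG module is acyclic if its homology vanishes. -/
def IsAcyclic (C : DGMod 𝒜) : Prop := ∀ x, C.d x = 0 → ∃ y, C.d y = x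

theorem d_proj (n : ℤ) (x : M.carrier) : M.d (M.proj n x) = M.proj (n - 1) (M.d x) :=
  GrMod.map_proj (M := M.toGrMod) (N := M.toGrMod) (f := M.d.toAddMonoidHom) (k := -1)
    (fun _ _ hx => M.d_mem hx) n x

theorem IsAcyclic.exists_mem (hC : M.IsAcyclic) {n : ℤ} {x : M.carrier} (hx : x ∈ M.grading n)
    (h : M.d x = 0) : ∃ y ∈ M.grading (n + 1), M.d y = x := by
  obtain ⟨y, rfl⟩ := hC x h
  refine ⟨M.proj (n + 1) y, GrMod.proj_mem _ _, ?_⟩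
  rw [d_proj, add_sub_cancel_right, GrMod.proj_of_mem hx]

/-- The path object of a DG module, with differential `d (a, b, c) = (d a, d b, a - b - d c)`: a
morphism to it is a homotopy `c` between the morphisms `a` and `b`. -/
abbrev path (X : DGMod 𝒜) : DGMod 𝒜 where
  toGrMod := X.prod (X.prod (X.shift (-1)))
  d := (X.d ∘ₗ LinearMap.fst R _ _).prod ((X.d ∘ₗ LinearMap.fst R _ _ ∘ₗ LinearMap.snd R _ _).prod
    (LinearMap.fst R _ _ - LinearMap.fst R _ _ ∘ₗ LinearMap.snd R _ _ -
      X.d ∘ₗ LinearMap.snd R _ _ ∘ₗ LinearMap.snd R _ _))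
  d_mem {n x} hx := by
    refine ⟨X.d_mem hx.1, X.d_mem hx.2.1, ?_⟩
    have h1 : X.d x.2.2 ∈ X.grading (n - -1 - 1) := X.d_mem hx.2.2
    change x.1 - x.2.1 - X.d x.2.2 ∈ X.grading (n - 1 - -1)
    rw [sub_neg_eq_add, add_sub_cancel_right] at h1
    rw [sub_neg_eq_add, sub_add_cancel]
    exact sub_mem (sub_mem hx.1 hx.2.1) h1
  d_d x := by
    refine Prod.ext (X.d_d _) (Prod.ext (X.d_d _) ?_)
    simp [X.d_d]

/-- The mapping cone of a morphism `f` of DG modules, with `d (y, x) = (d y + f x, -d x)`. -/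
abbrev cone (f : M ⟶ N) : DGMod 𝒜 where
  toGrMod := N.prod (M.shift 1)
  d := (N.d ∘ₗ LinearMap.fst R _ _ + Hom.toLinearMap f ∘ₗ LinearMap.snd R _ _).prod
    (-(M.d ∘ₗ LinearMap.snd R _ _))
  d_mem hx := ⟨add_mem (N.d_mem hx.1) (Hom.map_mem f hx.2), neg_mem (M.d_mem hx.2)⟩
  d_d x := by
    refine Prod.ext ?_ ?_
    · simp [N.d_d, Hom.map_d f]
    · simp [M.d_d]

/-- The desuspension of a DG module: an element of degree `n + 1` gets degree `n`, and the
differential changes its sign. -/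
abbrev desuspension (M : DGMod 𝒜) : DGMod 𝒜 where
  toGrMod := M.shift (-1)
  d := -M.d
  d_mem {n x} hx := by
    have h : n - 1 - -1 = n - -1 - 1 := by ring
    change -M.d x ∈ M.grading (n - 1 - -1)
    rw [h]
    exact neg_mem (M.d_mem hx)
  d_d x := by simp [M.d_d]

theorem IsAcyclic.desuspension (hC : M.IsAcyclic) : M.desuspension.IsAcyclic := fun x hx => by
  obtain ⟨y, hy⟩ := hC x (neg_eq_zero.1 hx)
  exact ⟨-y, by simpa using hy⟩

theorem isAcyclic_cone {f : M ⟶ N} (hf : quasiIso 𝒜 f) : (cone f).IsAcyclic := by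
  rw [quasiIso_iff] at hf
  rintro ⟨y, x⟩ h
  have h1 : N.d y + Hom.toLinearMap f x = 0 := congrArg Prod.fst h
  have h2 : M.d x = 0 := neg_eq_zero.1 (congrArg Prod.snd h)
  obtain ⟨x', hx'⟩ := hf.2 x h2 (-y) (by rw [map_neg, eq_neg_of_add_eq_zero_right h1])
  obtain ⟨z, hz, w, hw⟩ := hf.1 (y + Hom.toLinearMap f x') (by
    rw [map_add, ← Hom.map_d f, hx', h1])
  refine ⟨(-w, z - x'), Prod.ext ?_ ?_⟩
  · change N.d (-w) + Hom.toLinearMap f (z - x') = y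
    rw [map_neg, map_sub, hw]
    abel
  · simp [hz, hx']

/-- Two morphisms `f` and `g` of DG modules are homotopic if `f - g = d h + h d` for a linear map
`h` of degree one. -/
def Homotopic (f g : M ⟶ N) : Prop :=
  ∃ h : M.carrier →ₗ[R] N.carrier, (∀ n, ∀ x ∈ M.grading n, h x ∈ N.grading (n + 1)) ∧
    ∀ x, Hom.toLinearMap f x = Hom.toLinearMap g x + (N.d (h x) + h (M.d x))

theorem Homotopic.refl (f : M ⟶ N) : Homotopic f f := ⟨0, fun _ _ _ => zero_mem _, by simp⟩

theorem Homotopic.symm {f g : M ⟶ N} (H : Homotopic f g) : Homotopic g f := by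
  obtain ⟨h, hdeg, hh⟩ := H
  exact ⟨-h, fun n x hx => neg_mem (hdeg n x hx), fun x => by
    rw [hh]
    simp only [LinearMap.neg_apply, map_neg]
    abel⟩

theorem Homotopic.trans {f g k : M ⟶ N} (H : Homotopic f g) (H' : Homotopic g k) :
    Homotopic f k := by
  obtain ⟨h, hdeg, hh⟩ := H
  obtain ⟨h', hdeg', hh'⟩ := H'
  exact ⟨h + h', fun n x hx => add_mem (hdeg n x hx) (hdeg' n x hx), fun x => by
    rw [hh, hh']
    simp only [LinearMap.add_apply, map_add]
    abel⟩

theorem Homotopic.comp_right {f g : M ⟶ N} (H : Homotopic f g) (k : N ⟶ X) :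
    Homotopic (f ≫ k) (g ≫ k) := by
  obtain ⟨h, hdeg, hh⟩ := H
  refine ⟨Hom.toLinearMap k ∘ₗ h, fun n x hx => Hom.map_mem k (hdeg n x hx), fun x => ?_⟩
  change Hom.toLinearMap k (Hom.toLinearMap f x) = Hom.toLinearMap k (Hom.toLinearMap g x) +
    (X.d (Hom.toLinearMap k (h x)) + Hom.toLinearMap k (h (M.d x)))
  rw [hh, map_add, map_add, Hom.map_d k]

/-- The constant homotopies. -/
def pathConst (X : DGMod 𝒜) : X ⟶ path X where
  toLinearMap := LinearMap.id.prod (LinearMap.id.prod 0)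
  map_mem hx := ⟨hx, hx, zero_mem _⟩
  map_d x := by simp

/-- The source of a homotopy. -/
def pathSource (X : DGMod 𝒜) : path X ⟶ X where
  toLinearMap := LinearMap.fst R _ _
  map_mem hx := hx.1
  map_d _ := rfl

/-- The target of a homotopy. -/
def pathTarget (X : DGMod 𝒜) : path X ⟶ X where
  toLinearMap := LinearMap.fst R _ _ ∘ₗ LinearMap.snd R _ _
  map_mem hx := hx.2.1
  map_d _ := rfl

theorem quasiIso_pathConst (X : DGMod 𝒜) : quasiIso 𝒜 (pathConst X) := by
  rw [quasiIso_iff]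
  constructor
  · rintro ⟨a, b, c⟩ hz
    have ha : X.d a = 0 := congrArg Prod.fst hz
    have hc : a - b - X.d c = 0 := congrArg (fun z => z.2.2) hz
    refine ⟨a, ha, (0, c, 0), Prod.ext ?_ (Prod.ext ?_ ?_)⟩
    · change a = a + X.d 0
      rw [map_zero, add_zero]
    · change a = b + X.d c
      rw [← sub_eq_zero.1 hc, add_sub_cancel]
    · change 0 = c + (0 - c - X.d 0)
      rw [map_zero]
      abel
  · rintro x - ⟨a, b, c⟩ hw
    exact ⟨a, (congrArg Prod.fst hw).symm⟩

theorem Q_map_pathSource (X : DGMod 𝒜) : (Q 𝒜).map (pathSource X) = (Q 𝒜).map (pathTarget X) := by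
  have : IsIso ((Q 𝒜).map (pathConst X)) :=
    Localization.inverts (Q 𝒜) (quasiIso 𝒜) _ (quasiIso_pathConst X)
  rw [← cancel_epi ((Q 𝒜).map (pathConst X)), ← Functor.map_comp, ← Functor.map_comp]
  rfl

theorem Homotopic.Q_map_eq {f g : M ⟶ N} (H : Homotopic f g) : (Q 𝒜).map f = (Q 𝒜).map g := by
  obtain ⟨h, hdeg, hh⟩ := H
  let k : M ⟶ path N :=
    { toLinearMap := (Hom.toLinearMap f).prod ((Hom.toLinearMap g).prod h)
      map_mem := fun {n x} hx => ⟨Hom.map_mem f hx, Hom.map_mem g hx, by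
        change h x ∈ N.grading (n - -1)
        rw [sub_neg_eq_add]
        exact hdeg n x hx⟩
      map_d := fun x => by
        refine Prod.ext (Hom.map_d f x) (Prod.ext (Hom.map_d g x) ?_)
        change h (M.d x) = Hom.toLinearMap f x - Hom.toLinearMap g x - N.d (h x)
        rw [hh]
        abel }
  have hf : f = k ≫ pathSource N := rfl
  have hg : g = k ≫ pathTarget N := rfl
  rw [hf, hg, Functor.map_comp, Functor.map_comp, Q_map_pathSource]

/-- A DG module is homotopically projective if all morphisms from it to acyclic DG modules are
null-homotopic. -/
def IsKProjective (P : DGMod 𝒜) : Prop :=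
  ∀ (C : DGMod 𝒜), C.IsAcyclic → ∀ f : P ⟶ C, ∃ h : P.carrier →ₗ[R] C.carrier,
    (∀ n, ∀ x ∈ P.grading n, h x ∈ C.grading (n + 1)) ∧
      ∀ x, C.d (h x) + h (P.d x) = Hom.toLinearMap f x

theorem IsKProjective.exists_lift (hP : P.IsKProjective) {s : X ⟶ Y} (hs : quasiIso 𝒜 s)
    (f : P ⟶ Y) : ∃ g : P ⟶ X, Homotopic f (g ≫ s) := by
  obtain ⟨h, hdeg, hh⟩ := hP _ (isAcyclic_cone hs)
    { toLinearMap := (Hom.toLinearMap f).prod 0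
      map_mem := fun hx => ⟨Hom.map_mem f hx, zero_mem _⟩
      map_d := fun x => by
        refine Prod.ext ?_ ?_
        · change Hom.toLinearMap f (P.d x) = Y.d (Hom.toLinearMap f x) + Hom.toLinearMap s 0
          rw [Hom.map_d f, map_zero, add_zero]
        · change 0 = -X.d 0
          rw [map_zero, neg_zero] }
  refine ⟨{ toLinearMap := LinearMap.snd R _ _ ∘ₗ h
            map_mem := fun {n x} hx => ?_
            map_d := fun x => ?_ }, LinearMap.fst R _ _ ∘ₗ h, fun n x hx => (hdeg n x hx).1,
            fun x => ?_⟩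
  · have h1 : (h x).2 ∈ X.grading (n + 1 - 1) := (hdeg n x hx).2
    rwa [add_sub_cancel_right] at h1
  · have h1 : -X.d (h x).2 + (h (P.d x)).2 = 0 := congrArg Prod.snd (hh x)
    exact (neg_add_eq_zero.1 h1).symm
  · have h1 : Y.d (h x).1 + Hom.toLinearMap s (h x).2 + (h (P.d x)).1 = Hom.toLinearMap f x :=
      congrArg Prod.fst (hh x)
    change Hom.toLinearMap f x = Hom.toLinearMap s (h x).2 + (Y.d (h x).1 + (h (P.d x)).1)
    rw [← h1]
    abel

theorem IsKProjective.homotopic_of_comp (hP : P.IsKProjective) {s : X ⟶ Y} (hs : quasiIso 𝒜 s)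
    {f g : P ⟶ X} (H : Homotopic (f ≫ s) (g ≫ s)) : Homotopic f g := by
  obtain ⟨k, kdeg, hk⟩ := H
  have hk : ∀ x, Hom.toLinearMap s (Hom.toLinearMap f x) =
    Hom.toLinearMap s (Hom.toLinearMap g x) + (Y.d (k x) + k (P.d x)) := hk
  obtain ⟨h, hdeg, hh⟩ := hP _ (isAcyclic_cone hs).desuspension
    { toLinearMap := (-k).prod (Hom.toLinearMap f - Hom.toLinearMap g)
      map_mem := fun {n x} hx => by
        constructor
        · change -k x ∈ Y.grading (n - -1)
          rw [sub_neg_eq_add]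
          exact neg_mem (kdeg n x hx)
        · change Hom.toLinearMap f x - Hom.toLinearMap g x ∈ X.grading (n - -1 - 1)
          rw [sub_neg_eq_add, add_sub_cancel_right]
          exact sub_mem (Hom.map_mem f hx) (Hom.map_mem g hx)
      map_d := fun x => by
        refine Prod.ext ?_ ?_
        · change -k (P.d x) = -(Y.d (-k x) +
            Hom.toLinearMap s (Hom.toLinearMap f x - Hom.toLinearMap g x))
          rw [map_neg, map_sub, hk]
          abel
        · change Hom.toLinearMap f (P.d x) - Hom.toLinearMap g (P.d x) =
            - -X.d (Hom.toLinearMap f x - Hom.toLinearMap g x)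
          rw [Hom.map_d f, Hom.map_d g, map_sub, neg_neg] }
  refine ⟨LinearMap.snd R _ _ ∘ₗ h, fun n x hx => ?_, fun x => ?_⟩
  · have h1 : (h x).2 ∈ X.grading (n + 1 - -1 - 1) := (hdeg n x hx).2
    rwa [sub_neg_eq_add, add_sub_cancel_right] at h1
  · have h1 : - -X.d (h x).2 + (h (P.d x)).2 = Hom.toLinearMap f x - Hom.toLinearMap g x :=
      congrArg Prod.snd (hh x)
    rw [neg_neg] at h1
    change Hom.toLinearMap f x = Hom.toLinearMap g x + (X.d (h x).2 + (h (P.d x)).2)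
    rw [h1, add_sub_cancel]

/-- The setoid of homotopic morphisms. -/
def homotopySetoid (P X : DGMod 𝒜) : Setoid (P ⟶ X) where
  r := Homotopic
  iseqv := ⟨Homotopic.refl, Homotopic.symm, Homotopic.trans⟩

/-- The functor of homotopy classes of morphisms from a DG module. -/
def homotopyClasses (P : DGMod 𝒜) : DGMod 𝒜 ⥤ Type u where
  obj X := Quotient (homotopySetoid P X)
  map {X Y} k := TypeCat.ofHom (Quotient.map (sa := homotopySetoid P X) (sb := homotopySetoid P Y)
    (fun f => f ≫ k) fun _ _ H => Homotopic.comp_right H k)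
  map_id X := by
    ext f
    induction f using Quotient.inductionOn
    rfl
  map_comp k l := by
    ext f
    induction f using Quotient.inductionOn
    rfl

theorem IsKProjective.isInvertedBy (hP : P.IsKProjective) :
    (quasiIso 𝒜).IsInvertedBy (homotopyClasses P) := by
  intro X Y s hs
  rw [isIso_iff_bijective]
  constructor
  · intro f g
    induction f using Quotient.inductionOn
    induction g using Quotient.inductionOn
    intro h
    exact Quotient.sound (s := homotopySetoid P X)
      (hP.homotopic_of_comp hs (Quotient.exact (s := homotopySetoid P Y) h))
  · intro f
    induction f using Quotient.inductionOn with
    | h f =>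
    obtain ⟨g, hg⟩ := hP.exists_lift hs f
    exact ⟨Quotient.mk _ g, Quotient.sound (s := homotopySetoid P Y) hg.symm⟩

theorem IsKProjective.homotopic_of_Q_map_eq (hP : P.IsKProjective) {f g : P ⟶ X}
    (h : (Q 𝒜).map f = (Q 𝒜).map g) : Homotopic f g := by
  let e := eqToIso (Localization.Construction.fac (homotopyClasses P) hP.isInvertedBy)
  have hmap : (homotopyClasses P).map f = (homotopyClasses P).map g := by
    rw [← cancel_epi (e.hom.app P), ← e.hom.naturality f, ← e.hom.naturality g, Functor.comp_map,
      Functor.comp_map, h]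
  have := ConcreteCategory.congr_hom hmap (Quotient.mk (homotopySetoid P P) (𝟙 P))
  exact Quotient.exact (s := homotopySetoid P X) this

theorem IsKProjective.exists_Q_map_eq (hP : P.IsKProjective)
    (φ : (Q 𝒜).obj P ⟶ (Q 𝒜).obj X) : ∃ f : P ⟶ X, (Q 𝒜).map f = φ := by
  -- The derived category is generated by the images of the morphisms of DG modules and by the
  -- inverses of quasi-isomorphisms; composition with either preserves the image of `Hom(P, -)`.
  let IsImage : ∀ A : Derived 𝒜, ((Q 𝒜).obj P ⟶ A) → Prop := fun A u =>
    ∃ (X : DGMod 𝒜) (f : P ⟶ X) (h : (Q 𝒜).obj X = A), (Q 𝒜).map f ≫ eqToHom h = u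
  let W : MorphismProperty (Derived 𝒜) := fun A B φ =>
    ∀ u, IsImage A u → IsImage B (u ≫ φ)
  have hinj : ∀ X Y : DGMod 𝒜, (Q 𝒜).obj X = (Q 𝒜).obj Y → X = Y := fun X Y h =>
    (Localization.Construction.objEquiv (quasiIso 𝒜)).injective h
  have : W.IsStableUnderComposition :=
    ⟨fun φ ψ hφ hψ u hu => by
      rw [← Category.assoc]
      exact hψ _ (hφ u hu)⟩
  have htop : W = ⊤ := by
    refine Localization.Construction.morphismProperty_eq_top W ?_ ?_
    · rintro X Y k _ ⟨X', f, h, rfl⟩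
      obtain rfl := hinj _ _ h
      exact ⟨Y, f ≫ k, rfl, by simp⟩
    · rintro X Y s hs _ ⟨Y', f, h, rfl⟩
      obtain rfl := hinj _ _ h
      obtain ⟨g, hg⟩ := hP.exists_lift hs f
      refine ⟨X, g, rfl, ?_⟩
      have h1 : (Q 𝒜).map f = (Q 𝒜).map g ≫ (Localization.Construction.wIso s hs).hom := by
        rw [hg.Q_map_eq, Functor.map_comp]
        rfl
      rw [eqToHom_refl, eqToHom_refl, Category.comp_id, Category.comp_id, h1, Category.assoc,
        Iso.hom_inv_id, Category.comp_id]
  have hφ : W φ := htop ▸ MorphismProperty.top_apply φ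
  obtain ⟨X', f, h, hf⟩ := hφ (𝟙 _) ⟨P, 𝟙 P, rfl, by simp⟩
  obtain rfl := hinj _ _ h
  exact ⟨f, by simpa using hf⟩

theorem IsSmall.of_iso (hM : M.IsSmall) (e : (Q 𝒜).obj M ≅ (Q 𝒜).obj N) : N.IsSmall := by
  intro ι X f
  obtain ⟨s, g, hg⟩ := hM ι X (e.hom ≫ f)
  exact ⟨s, e.inv ≫ g, by rw [Category.assoc, hg, Iso.inv_hom_id_assoc]⟩

theorem IsSmall.of_quasiIso (hM : M.IsSmall) {f : M ⟶ N} (hf : quasiIso 𝒜 f) : N.IsSmall :=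
  hM.of_iso (Localization.Construction.wIso f hf)

/-- The projection of a direct sum to a summand. -/
def directSumComponent {ι : Type u} (X : ι → DGMod 𝒜) (j : ι) : directSum X ⟶ X j where
  toLinearMap := DirectSum.component R ι (fun i => (X i).carrier) j
  map_mem hx := hx j
  map_d _ := rfl

theorem exists_comp_directSumIncl {ι : Type u} {X : ι → DGMod 𝒜} (s : Finset ι)
    (f : P ⟶ directSum X)
    (hf : ∀ x, ∀ j ∉ s, Hom.toLinearMap (directSumComponent X j) (Hom.toLinearMap f x) = 0) :
    ∃ g : P ⟶ directSum (fun i : s => X i), g ≫ directSumIncl X s = f := by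
  classical
  let F : P.carrier →ₗ[R] DirectSum ι fun i => (X i).carrier := Hom.toLinearMap f
  refine ⟨{ toLinearMap := (DFinsupp.subtypeDomainLinearMap R (fun i => (X i).carrier) (· ∈ s)) ∘ₗ F
            map_mem := fun hx i => Hom.map_mem f hx i
            map_d := fun x => DFinsupp.ext fun i => ?_ }, ?_⟩
  · exact DFunLike.congr_fun (F := DirectSum ι fun i => (X i).carrier) (Hom.map_d f x) (i : ι)
  · refine Hom.ext (LinearMap.ext fun x => DFinsupp.ext fun j => ?_)
    refine (directSumInclLinear_apply X s _ j).trans ?_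
    split_ifs with h
    · rfl
    · exact (hf x j h).symm

theorem IsKProjective.isSmall (hP : P.IsKProjective) [hfin : Module.Finite R P.carrier] :
    P.IsSmall := by
  classical
  intro ι X φ
  obtain ⟨f, rfl⟩ := hP.exists_Q_map_eq φ
  let F : P.carrier →ₗ[R] DirectSum ι fun i => (X i).carrier := Hom.toLinearMap f
  obtain ⟨t, ht⟩ := hfin.fg_top
  let s : Finset ι := t.biUnion fun x => DFinsupp.support (F x)
  have hs (j) (hj : j ∉ s) : DirectSum.component R ι (fun i => (X i).carrier) j ∘ₗ F = 0 :=
    LinearMap.ext_on ht fun x hx => DFinsupp.notMem_support_iff.1 fun h =>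
      hj (Finset.mem_biUnion.2 ⟨x, hx, h⟩)
  obtain ⟨g, hg⟩ := exists_comp_directSumIncl s f fun x j hj => LinearMap.congr_fun (hs j hj) x
  exact ⟨s, (Q 𝒜).map g, by rw [← Functor.map_comp, hg]⟩

end DGMod

section BaseChange

open IsLocalRing TensorProduct

variable {R : Type u} [CommRing R] {S : Type u} [CommRing S] [Algebra R S] [IsLocalRing S]
  {I : Ideal R} {K F N : Type u} [AddCommGroup K] [Module R K] [AddCommGroup F] [Module R F]
  [AddCommGroup N] [Module R N]

theorem range_baseChange_le (hI : I.map (algebraMap R S) ≤ maximalIdeal S) {f : K →ₗ[R] F}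
    (hf : LinearMap.range f ≤ I • ⊤) :
    LinearMap.range (f.baseChange S) ≤ maximalIdeal S • (⊤ : Submodule S (S ⊗[R] F)) := by
  rintro _ ⟨t, rfl⟩
  induction t using TensorProduct.induction_on with
  | zero => rw [map_zero]; exact zero_mem _
  | add x y hx hy => rw [map_add]; exact add_mem hx hy
  | tmul s k =>
    rw [LinearMap.baseChange_tmul]
    have h : f k ∈ I • (⊤ : Submodule R F) := hf ⟨k, rfl⟩
    generalize f k = y at h ⊢
    induction h using Submodule.smul_induction_on' with
    | smul a ha y _ =>
      rw [← TensorProduct.smul_tmul, ← algebraMap_smul S a s, ← TensorProduct.smul_tmul']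
      exact Submodule.smul_mem_smul (hI (Ideal.mem_map_of_mem _ ha)) trivial
    | add x _ y _ hx hy => rw [TensorProduct.tmul_add]; exact add_mem hx hy

theorem ProjDimLT.baseChange_left_of_minimal [Module.Flat R S]
    (hI : I.map (algebraMap R S) ≤ maximalIdeal S) [Module.Projective R F] [Module.Finite R K]
    {f : K →ₗ[R] F} {g : F →ₗ[R] N} (hf : Function.Injective f) (hfg : Function.Exact f g)
    (hg : Function.Surjective g) (hmin : LinearMap.range f ≤ I • ⊤) {n : ℕ}
    (h : ProjDimLT S (S ⊗[R] N) (n + 1)) : ProjDimLT S (S ⊗[R] K) n :=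
  ProjDimLT.left_of_minimal (f := f.baseChange S) (g := g.baseChange S)
    (Module.Flat.lTensor_preserves_injective_linearMap f hf) (lTensor_exact S hfg hg)
    (LinearMap.lTensor_surjective S hg) (maximalIdeal_le_jacobson _)
    (range_baseChange_le hI hmin) h

theorem subsingleton_of_subsingleton_baseChange [Module.Flat R S] [IsNoetherianRing R]
    (hI : I.map (algebraMap R S) ≤ maximalIdeal S) {r : ℕ} {g : (Fin r → R) →ₗ[R] N}
    (hg : Function.Surjective g) (hmin : LinearMap.ker g ≤ I • ⊤)
    (h : Subsingleton (S ⊗[R] N)) : Subsingleton N := by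
  have hK := ProjDimLT.baseChange_left_of_minimal (n := 0) hI
    (f := (LinearMap.ker g).subtype) (Submodule.subtype_injective _)
    (LinearMap.exact_subtype_ker_map g) hg (by rwa [Submodule.range_subtype])
    ((projDimLT_zero_iff.2 h).mono (Nat.zero_le _))
  rw [projDimLT_zero_iff] at hK
  have hex := lTensor_exact S (LinearMap.exact_subtype_ker_map g) hg
  have hF : Subsingleton (S ⊗[R] (Fin r → R)) := by
    refine ⟨fun x y => ?_⟩
    obtain ⟨k, hk⟩ := (hex (x - y)).1 (Subsingleton.elim _ _)
    rw [Subsingleton.elim k 0, map_zero] at hk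
    exact sub_eq_zero.1 hk.symm
  have hS : Subsingleton (Fin r → S) :=
    (TensorProduct.piScalarRight R R S (Fin r)).symm.injective.subsingleton
  have : IsEmpty (Fin r) := ⟨fun i => zero_ne_one (congrFun
    (Subsingleton.elim (0 : Fin r → S) 1) i)⟩
  exact hg.subsingleton

end BaseChange

namespace DGMod

variable {R : Type u} [CommRing R] {𝒜 : ℤ → AddSubgroup R} {M N P X Y : DGMod 𝒜}

section Extension

variable {f : N ⟶ M} (hN : N.d = 0) (g : P ⟶ cone f)

/-- The extension of `P` by `N` classified by the second component of a morphism from `P` to the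
cone of a morphism out of `N`. -/
abbrev extension : DGMod 𝒜 where
  toGrMod := P.prod N.toGrMod
  d := (P.d ∘ₗ LinearMap.fst R _ _).prod
    (-(LinearMap.snd R _ _ ∘ₗ Hom.toLinearMap g ∘ₗ LinearMap.fst R _ _))
  d_mem hx := ⟨P.d_mem hx.1, (N.grading _).neg_mem (Hom.map_mem g hx.1).2⟩
  d_d x := by
    refine Prod.ext (P.d_d _) ?_
    have h1 : (Hom.toLinearMap g (P.d x.1)).2 = -N.d (Hom.toLinearMap g x.1).2 :=
      congrArg Prod.snd (Hom.map_d g x.1)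
    change -(Hom.toLinearMap g (P.d x.1)).2 = 0
    rw [h1, hN, LinearMap.zero_apply, neg_zero, neg_zero]

/-- The morphism from the extension to the target of the morphism `f` whose cone defines it. -/
abbrev extensionHom : extension hN g ⟶ M where
  toLinearMap := LinearMap.fst R _ _ ∘ₗ Hom.toLinearMap g ∘ₗ LinearMap.fst R _ _ +
    Hom.toLinearMap f ∘ₗ LinearMap.snd R _ _
  map_mem hx := add_mem (Hom.map_mem g hx.1).1 (Hom.map_mem f hx.2)
  map_d x := by
    have h1 : (Hom.toLinearMap g (P.d x.1)).1 =
        M.d (Hom.toLinearMap g x.1).1 + Hom.toLinearMap f (Hom.toLinearMap g x.1).2 :=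
      congrArg Prod.fst (Hom.map_d g x.1)
    change (Hom.toLinearMap g (P.d x.1)).1 + Hom.toLinearMap f (-(Hom.toLinearMap g x.1).2) =
      M.d ((Hom.toLinearMap g x.1).1 + Hom.toLinearMap f x.2)
    rw [h1, map_neg, map_add, ← Hom.map_d f, hN, LinearMap.zero_apply, map_zero]
    abel

theorem exists_extensionHom_eq_add_boundary (hg : quasiIso 𝒜 g) {z : M.carrier} (hz : M.d z = 0) :
    ∃ x, (extension hN g).d x = 0 ∧ ∃ w, Hom.toLinearMap (extensionHom hN g) x = z + M.d w := by
  obtain ⟨p, hp, ⟨w, a⟩, hw⟩ := ((quasiIso_iff g).1 hg).1 (z, 0) (Prod.ext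
    (by change M.d z + Hom.toLinearMap f 0 = 0; rw [hz, map_zero, add_zero])
    (by change -N.d 0 = 0; rw [map_zero, neg_zero]))
  have hgp₁ : (Hom.toLinearMap g p).1 = z + (M.d w + Hom.toLinearMap f a) := congrArg Prod.fst hw
  have hgp₂ : (Hom.toLinearMap g p).2 = 0 + -N.d a := congrArg Prod.snd hw
  rw [hN, LinearMap.zero_apply, neg_zero, add_zero] at hgp₂
  refine ⟨(p, -a), Prod.ext hp ?_, w, ?_⟩
  · change -(Hom.toLinearMap g p).2 = 0
    rw [hgp₂, neg_zero]
  · change (Hom.toLinearMap g p).1 + Hom.toLinearMap f (-a) = z + M.d w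
    rw [hgp₁, map_neg]
    abel

theorem exists_extension_d_eq (hg : quasiIso 𝒜 g) {x : P.carrier × N.carrier}
    (hx : (extension hN g).d x = 0) {w : M.carrier}
    (hw : Hom.toLinearMap (extensionHom hN g) x = M.d w) : ∃ y, (extension hN g).d y = x := by
  obtain ⟨hsurj, hinj⟩ := (quasiIso_iff g).1 hg
  obtain ⟨p, a⟩ := x
  have hp : P.d p = 0 := congrArg Prod.fst hx
  have hgp₂ : (Hom.toLinearMap g p).2 = 0 := neg_eq_zero.1 (congrArg Prod.snd hx)
  have hgp₁ : (Hom.toLinearMap g p).1 + Hom.toLinearMap f a = M.d w := hw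
  have hgp : Hom.toLinearMap g p = (cone f).d (w, -a) := by
    refine Prod.ext ?_ ?_
    · change (Hom.toLinearMap g p).1 = M.d w + Hom.toLinearMap f (-a)
      rw [← hgp₁, map_neg, add_neg_cancel_right]
    · change (Hom.toLinearMap g p).2 = -N.d (-a)
      rw [hgp₂, hN, LinearMap.zero_apply, neg_zero]
  obtain ⟨p', rfl⟩ := hinj p hp _ hgp
  obtain ⟨q, hq, ⟨w', b⟩, hw'⟩ := hsurj (Hom.toLinearMap g p' - (w, -a)) (by
    rw [map_sub, ← Hom.map_d g, hgp, sub_self])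
  have hgq₂ : (Hom.toLinearMap g q).2 = (Hom.toLinearMap g p').2 - -a + -N.d b :=
    congrArg Prod.snd hw'
  refine ⟨(p' - q, 0), Prod.ext ?_ ?_⟩
  · change P.d (p' - q) = P.d p'
    rw [map_sub, hq, sub_zero]
  · change -(Hom.toLinearMap g (p' - q)).2 = a
    rw [map_sub, Prod.snd_sub, hgq₂, hN, LinearMap.zero_apply]
    abel

theorem quasiIso_extensionHom (hg : quasiIso 𝒜 g) : quasiIso 𝒜 (extensionHom hN g) :=
  (quasiIso_iff _).2 ⟨fun _ hz => exists_extensionHom_eq_add_boundary hN g hg hz,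
    fun _ hx _ hw => exists_extension_d_eq hN g hg hx hw⟩

theorem IsKProjective.exists_d_comp_eq (hNproj : N.IsKProjective) {C : DGMod 𝒜} (hC : C.IsAcyclic)
    (χ : extension hN g ⟶ C) : ∃ k : N.carrier →ₗ[R] C.carrier,
      (∀ n, ∀ x ∈ N.grading n, k x ∈ C.grading (n + 1)) ∧
        ∀ x, C.d (k x) = Hom.toLinearMap χ (0, x) := by
  obtain ⟨k, kdeg, hk⟩ := hNproj C hC
    { toLinearMap := Hom.toLinearMap χ ∘ₗ LinearMap.inr R _ _
      map_mem := fun hx => Hom.map_mem χ ⟨zero_mem _, hx⟩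
      map_d := fun x => by
        have hx : (extension hN g).d ((0 : P.carrier), x) = 0 := Prod.ext
          (map_zero P.d) (by
            change -(Hom.toLinearMap g 0).2 = 0
            rw [map_zero, Prod.snd_zero, neg_zero])
        change Hom.toLinearMap χ (0, N.d x) = C.d (Hom.toLinearMap χ (0, x))
        rw [← Hom.map_d χ, hx, hN, LinearMap.zero_apply]
        rfl }
  refine ⟨k, kdeg, fun x => ?_⟩
  have hx : C.d (k x) + k (N.d x) = Hom.toLinearMap χ (0, x) := hk x
  rwa [hN, LinearMap.zero_apply, map_zero, add_zero] at hx

theorem toLinearMap_extension_apply {C : DGMod 𝒜} (χ : extension hN g ⟶ C) (p : P.carrier)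
    (a : N.carrier) : Hom.toLinearMap χ (p, a) =
      Hom.toLinearMap χ (p, 0) + Hom.toLinearMap χ (0, a) := by
  rw [← map_add]
  exact congrArg _ (Prod.ext (add_zero _).symm (zero_add _).symm)

/-- A morphism from the extension whose restriction to `N` is null-homotopic, corrected by the
null-homotopy so as to define a morphism on `P`. -/
def extensionRestrict {C : DGMod 𝒜} (χ : extension hN g ⟶ C) (k : N.carrier →ₗ[R] C.carrier)
    (kdeg : ∀ n, ∀ x ∈ N.grading n, k x ∈ C.grading (n + 1))
    (hk : ∀ x, C.d (k x) = Hom.toLinearMap χ (0, x)) : P ⟶ C where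
  toLinearMap := Hom.toLinearMap χ ∘ₗ LinearMap.inl R _ _ +
    k ∘ₗ LinearMap.snd R _ _ ∘ₗ Hom.toLinearMap g
  map_mem {n x} hx := by
    have hkx := kdeg (n - 1) _ (Hom.map_mem g hx).2
    rw [sub_add_cancel] at hkx
    exact add_mem (Hom.map_mem χ ⟨hx, zero_mem _⟩) hkx
  map_d x := by
    have hgd : (Hom.toLinearMap g (P.d x)).2 = -N.d (Hom.toLinearMap g x).2 :=
      congrArg Prod.snd (Hom.map_d g x)
    have hχd : Hom.toLinearMap χ (P.d x, -(Hom.toLinearMap g x).2) =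
      C.d (Hom.toLinearMap χ (x, 0)) := Hom.map_d χ (x, 0)
    change Hom.toLinearMap χ (P.d x, 0) + k (Hom.toLinearMap g (P.d x)).2 =
      C.d (Hom.toLinearMap χ (x, 0) + k (Hom.toLinearMap g x).2)
    rw [hgd, hN, LinearMap.zero_apply, neg_zero, map_add, ← hχd,
      toLinearMap_extension_apply hN g χ _ (-_), ← hk, map_neg, map_neg, map_zero]
    abel

theorem IsKProjective.extension (hNproj : N.IsKProjective) (hP : P.IsKProjective) :
    (extension hN g).IsKProjective := by
  intro C hC χ
  obtain ⟨k, kdeg, hk⟩ := hNproj.exists_d_comp_eq hN g hC χ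
  obtain ⟨h, hdeg, hh⟩ := hP C hC (extensionRestrict hN g χ k kdeg hk)
  refine ⟨h ∘ₗ LinearMap.fst R _ _ + k ∘ₗ LinearMap.snd R _ _,
    fun n x hx => add_mem (hdeg n _ hx.1) (kdeg n _ hx.2), fun x => ?_⟩
  have hx : C.d (h x.1) + h (P.d x.1) =
    Hom.toLinearMap χ (x.1, 0) + k (Hom.toLinearMap g x.1).2 := hh x.1
  change C.d (h x.1 + k x.2) + (h (P.d x.1) + k (-(Hom.toLinearMap g x.1).2)) =
    Hom.toLinearMap χ (x.1, x.2)
  rw [toLinearMap_extension_apply, map_add, hk, map_neg, eq_sub_of_add_eq hx]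
  abel

/-- The map to the homology of `M` induced by a morphism to `M` from a module with zero
differential. -/
def toHomology (f : N ⟶ M) (hN : N.d = 0) : N.carrier →ₗ[R] M.Homology :=
  Submodule.mkQ _ ∘ₗ (Hom.toLinearMap f).codRestrict (LinearMap.ker M.d) fun x => by
    rw [LinearMap.mem_ker, ← Hom.map_d f, hN, LinearMap.zero_apply, map_zero]

theorem toHomology_eq_zero_iff {x : N.carrier} :
    toHomology f hN x = 0 ↔ ∃ w, M.d w = Hom.toLinearMap f x :=
  Submodule.Quotient.mk_eq_zero _

theorem nonempty_homology_cone_equiv (hf : Function.Surjective (toHomology f hN)) :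
    Nonempty ((cone f).Homology ≃ₗ[R] LinearMap.ker (toHomology f hN)) := by
  let Φ : LinearMap.ker (cone f).d →ₗ[R] LinearMap.ker (toHomology f hN) :=
    LinearMap.codRestrict _ (LinearMap.snd R _ _ ∘ₗ (LinearMap.ker (cone f).d).subtype) (by
      rintro ⟨⟨x, a⟩, hx⟩
      have hxa : M.d x + Hom.toLinearMap f a = 0 := congrArg Prod.fst hx
      exact (toHomology_eq_zero_iff hN).2
        ⟨-x, by rw [map_neg]; exact neg_eq_of_add_eq_zero_right hxa⟩)
  have hΦ : (LinearMap.range (cone f).d).submoduleOf (LinearMap.ker (cone f).d) ≤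
      LinearMap.ker Φ := by
    rintro ⟨_, hx⟩ ⟨⟨y, b⟩, rfl⟩
    refine Subtype.ext ?_
    change -N.d b = 0
    rw [hN, LinearMap.zero_apply, neg_zero]
  refine ⟨LinearEquiv.ofBijective (Submodule.liftQ _ Φ hΦ) ⟨?_, ?_⟩⟩
  · rw [injective_iff_map_eq_zero]
    intro y hy
    obtain ⟨⟨⟨x, a⟩, hx⟩, rfl⟩ := Submodule.Quotient.mk_surjective _ y
    obtain rfl : a = 0 := congrArg Subtype.val hy
    have hdx : M.d x + Hom.toLinearMap f 0 = 0 := congrArg Prod.fst hx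
    rw [map_zero, add_zero] at hdx
    obtain ⟨a, ha⟩ := hf (Submodule.Quotient.mk ⟨x, hdx⟩)
    obtain ⟨w, hw⟩ := (Submodule.Quotient.eq _).1 ha
    have hw : M.d w = Hom.toLinearMap f a - x := hw
    refine (Submodule.Quotient.mk_eq_zero _).2 ⟨(-w, a), Prod.ext ?_ ?_⟩
    · change M.d (-w) + Hom.toLinearMap f a = x
      rw [map_neg, hw]
      abel
    · change -N.d a = 0
      rw [hN, LinearMap.zero_apply, neg_zero]
  · rintro ⟨a, ha⟩
    obtain ⟨w, hw⟩ := (toHomology_eq_zero_iff hN).1 ha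
    refine ⟨Submodule.Quotient.mk ⟨(-w, a), Prod.ext ?_ ?_⟩, rfl⟩
    · change M.d (-w) + Hom.toLinearMap f a = 0
      rw [← hw, map_neg, neg_add_cancel]
    · change -N.d a = 0
      rw [hN, LinearMap.zero_apply, neg_zero]

end Extension

theorem quasiIso_of_subsingleton [Subsingleton N.carrier] [Subsingleton M.Homology] (f : N ⟶ M) :
    quasiIso 𝒜 f :=
  have : Subsingleton N.Homology := (Submodule.mkQ_surjective _).subsingleton
  ⟨Function.injective_of_subsingleton _, fun y => ⟨0, Subsingleton.elim _ y⟩⟩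

end DGMod

namespace GrMod

variable {R : Type u} [CommRing R] {𝒜 : ℤ → AddSubgroup R}

/-- The kernel of a morphism of graded modules, as a graded module. -/
noncomputable abbrev Hom.ker {M N : GrMod 𝒜} (f : Hom M N) : GrMod 𝒜 :=
  M.ofSubmodule (LinearMap.ker f.toLinearMap) fun n x hx => by
    have hproj := map_proj (f := f.toLinearMap.toAddMonoidHom) (k := 0)
      (fun n x hx => (add_zero n).symm ▸ f.map_mem hx) n x
    rw [LinearMap.mem_ker] at hx ⊢
    exact hproj.trans ((congrArg _ hx).trans (map_zero _))

/-- A graded module `P` has cycle lifting if the linear maps of any degree `k` from `P` to the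
cycles of an acyclic DG module lift along the differential. This is the form in which the graded
projectivity of `P` is used. -/
def HasCycleLifting (P : GrMod 𝒜) : Prop :=
  ∀ C : DGMod 𝒜, C.IsAcyclic → ∀ (k : ℤ) (f : P.carrier →ₗ[R] C.carrier),
    (∀ l, ∀ x ∈ P.grading l, f x ∈ C.grading (l + k)) → (∀ x, C.d (f x) = 0) →
    ∃ h : P.carrier →ₗ[R] C.carrier,
      (∀ l, ∀ x ∈ P.grading l, h x ∈ C.grading (l + k + 1)) ∧ ∀ x, C.d (h x) = f x

theorem HasCycleLifting.isKProjective {P : GrMod 𝒜} (hP : P.HasCycleLifting) :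
    (DGMod.ofGrMod P).IsKProjective := by
  intro C hC f
  obtain ⟨h, hdeg, hh⟩ := hP C hC 0 (DGMod.Hom.toLinearMap f)
    (fun l x hx => (add_zero l).symm ▸ DGMod.Hom.map_mem f hx)
    (fun x => (DGMod.Hom.map_d f x).symm.trans (map_zero (DGMod.Hom.toLinearMap f)))
  simp only [add_zero] at hdeg
  refine ⟨h, hdeg, fun x => ?_⟩
  change C.d (h x) + h 0 = _
  rw [map_zero, add_zero]
  exact hh x

variable [GradedRing 𝒜]

theorem hasCycleLifting_free {r : ℕ} (deg : Fin r → ℤ) : (free 𝒜 deg).HasCycleLifting := by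
  intro C hC k f hf hd
  choose y hy hdy using fun i => hC.exists_mem (hf _ _ (single_mem_free deg i)) (hd _)
  refine ⟨Fintype.linearCombination R y, fun l x hx => ?_, LinearMap.congr_fun
    (f := C.d ∘ₗ Fintype.linearCombination R y) (g := f) ?_⟩
  · refine (freeHom (deg := fun i => deg i + k + 1) hy).map_mem (n := l + k + 1) (x := x)
      fun i _ => ?_
    change (x : Fin r → R) i ∈ 𝒜 (l + k + 1 - (deg i + k + 1))
    rw [add_sub_add_right_eq_sub, add_sub_add_right_eq_sub]
    exact hx i trivial
  · refine (Pi.basisFun R (Fin r)).ext fun i => ?_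
    rw [LinearMap.comp_apply, Pi.basisFun_apply, Fintype.linearCombination_apply_single, one_smul,
      hdy]

end GrMod

namespace DGMod

open IsLocalRing TensorProduct

variable {R : Type u} [CommRing R] {𝒜 : ℤ → AddSubgroup R}

/-- The cycles of a DG module, as a graded module. -/
noncomputable abbrev cycles (M : DGMod 𝒜) : GrMod 𝒜 :=
  M.toGrMod.ofSubmodule (LinearMap.ker M.d) fun n x hx => by
    rw [LinearMap.mem_ker] at hx ⊢
    rw [d_proj, hx, map_zero]

variable [GradedRing 𝒜]

/-- The morphism from a free graded module to a DG module sending the generators to given cycles. -/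
noncomputable def freeHom {M : DGMod 𝒜} {r : ℕ} {deg : Fin r → ℤ} {z : Fin r → M.cycles.carrier}
    (hz : ∀ i, z i ∈ M.cycles.grading (deg i)) : ofGrMod (GrMod.free 𝒜 deg) ⟶ M where
  toLinearMap := (LinearMap.ker M.d).subtype ∘ₗ Fintype.linearCombination R z
  map_mem := (GrMod.freeHom hz).map_mem
  map_d _ := (map_zero _).trans (LinearMap.mem_ker.1 (Subtype.property _)).symm

theorem exists_minimal_toHomology (m : HomogeneousIdeal 𝒜) [IsLocalGraded 𝒜 m] (M : DGMod 𝒜)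
    [Module.Finite R M.Homology] :
    ∃ (r : ℕ) (deg : Fin r → ℤ) (f : ofGrMod (GrMod.free 𝒜 deg) ⟶ M),
      Function.Surjective (toHomology f rfl) ∧
        LinearMap.ker (toHomology f rfl) ≤ m.toIdeal • (⊤ : Submodule R (Fin r → R)) := by
  let π : M.cycles.carrier →ₗ[R] M.Homology := Submodule.mkQ _
  have hπ : ∀ x, π x = 0 → ∀ n, π (M.cycles.proj n x) = 0 := fun x hx n => by
    obtain ⟨w, hw⟩ := (Submodule.Quotient.mk_eq_zero _).1 hx
    refine (Submodule.Quotient.mk_eq_zero _).2 ⟨M.proj (n + 1) w, ?_⟩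
    rw [d_proj, add_sub_cancel_right, hw]
    exact (GrMod.proj_ofSubmodule _ _ n x).symm
  obtain ⟨r, deg, z, hz, hspan, hmin⟩ :=
    GrMod.exists_minimal_generators m (M := M.cycles) π (Submodule.mkQ_surjective _) hπ
  let g : (Fin r → R) →ₗ[R] M.Homology := toHomology (freeHom hz) rfl
  have hg : g = Fintype.linearCombination R (π ∘ z) := LinearMap.ext fun a => by
    refine (congrArg π (Fintype.linearCombination_apply R z a)).trans ?_
    simp only [map_sum, map_smul, Fintype.linearCombination_apply, Function.comp_apply]
  refine ⟨r, deg, freeHom hz, ?_, fun (a : Fin r → R) (ha : g a = 0) => ?_⟩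
  · change Function.Surjective g
    rw [← LinearMap.range_eq_top, hg]
    exact (Fintype.range_linearCombination R _).trans hspan
  · rw [hg, Fintype.linearCombination_apply] at ha
    change a ∈ m.toIdeal • (⊤ : Submodule R (Fin r → R))
    rw [← (Pi.basisFun R (Fin r)).sum_repr a]
    exact sum_mem fun i _ => Submodule.smul_mem_smul (hmin a ha i) trivial

variable [IsNoetherianRing R] (m : HomogeneousIdeal 𝒜) [IsLocalGraded 𝒜 m]
  {S : Type u} [CommRing S] [Algebra R S] [IsLocalRing S] [Module.Flat R S]

-- Induction on the projective dimension over `S`: the cone of a minimal free cover of the homology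
-- of `M` has homology of smaller projective dimension, and the extension of its resolution by the
-- free module resolves `M`.
theorem exists_quasiIso_of_projDimLT (hS : m.toIdeal.map (algebraMap R S) ≤ maximalIdeal S) (n : ℕ)
    (M : DGMod 𝒜) (hfin : Module.Finite R M.Homology) (h : ProjDimLT S (S ⊗[R] M.Homology) n) :
    ∃ (P : DGMod 𝒜) (g : P ⟶ M), P.IsKProjective ∧ Module.Finite R P.carrier ∧ quasiIso 𝒜 g := by
  obtain ⟨r, deg, f, hf, hmin⟩ := exists_minimal_toHomology m M
  let π : (Fin r → R) →ₗ[R] M.Homology := toHomology f rfl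
  cases n with
  | zero =>
    have : Subsingleton M.Homology :=
      subsingleton_of_subsingleton_baseChange hS (g := π) hf hmin (projDimLT_zero_iff.1 h)
    let P : DGMod 𝒜 := ofGrMod (GrMod.free 𝒜 (Fin.elim0 : Fin 0 → ℤ))
    have : Subsingleton P.carrier := inferInstanceAs (Subsingleton (Fin 0 → R))
    let g : P ⟶ M := ⟨0, fun _ => zero_mem _, fun _ => (map_zero M.d).symm⟩
    exact ⟨P, g, (GrMod.hasCycleLifting_free _).isKProjective,
      inferInstanceAs (Module.Finite R (Fin 0 → R)), quasiIso_of_subsingleton g⟩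
  | succ n =>
    obtain ⟨e⟩ := nonempty_homology_cone_equiv rfl hf
    let e : (cone f).Homology ≃ₗ[R] LinearMap.ker π := e
    have hker : ProjDimLT S (S ⊗[R] LinearMap.ker π) n :=
      ProjDimLT.baseChange_left_of_minimal hS (f := (LinearMap.ker π).subtype)
        (Submodule.subtype_injective _) (LinearMap.exact_subtype_ker_map π) hf
        (by rwa [Submodule.range_subtype]) h
    obtain ⟨P, k, hP, _, hk⟩ := exists_quasiIso_of_projDimLT hS n (cone f)
      (Module.Finite.equiv e.symm) (hker.of_equiv (e.symm.baseChange R S _ _))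
    exact ⟨extension rfl k, extensionHom rfl k,
      (GrMod.hasCycleLifting_free deg).isKProjective.extension rfl k hP,
      inferInstanceAs (Module.Finite R (P.carrier × (Fin r → R))), quasiIso_extensionHom rfl k hk⟩

theorem isSmall_of_projDimLT (hS : m.toIdeal.map (algebraMap R S) ≤ maximalIdeal S) {n : ℕ}
    {M : DGMod 𝒜} (hfin : Module.Finite R M.Homology) (h : ProjDimLT S (S ⊗[R] M.Homology) n) :
    M.IsSmall := by
  obtain ⟨P, g, hP, _, hg⟩ := exists_quasiIso_of_projDimLT m hS n M hfin h
  exact hP.isSmall.of_quasiIso hg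

end DGMod

namespace GrMod

variable {R : Type u} [CommRing R] {𝒜 : ℤ → AddSubgroup R} [GradedRing 𝒜]
  (m : HomogeneousIdeal 𝒜) [IsLocalGraded 𝒜 m]

theorem exists_minimal_cover (M : GrMod 𝒜) [Module.Finite R M.carrier] :
    ∃ (r : ℕ) (deg : Fin r → ℤ) (ε : Hom (free 𝒜 deg) M), Function.Surjective ε.toLinearMap ∧
      ∀ x, ε.toLinearMap x = 0 → ∀ i, x i ∈ m.toIdeal := by
  obtain ⟨r, deg, z, hz, hspan, hmin⟩ := exists_minimal_generators m (M := M) LinearMap.id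
    Function.surjective_id fun x hx n => by
      rw [LinearMap.id_apply] at hx ⊢
      rw [hx, map_zero]
  refine ⟨r, deg, freeHom hz, ?_, fun x hx => hmin x ?_⟩
  · rw [← LinearMap.range_eq_top]
    exact (Fintype.range_linearCombination R _).trans hspan
  · exact (Fintype.linearCombination_apply R z x).symm.trans hx

theorem exists_minimal_resolution [IsNoetherianRing R] (M : GrMod 𝒜)
    [hM : Module.Finite R M.carrier] :
    ∃ (r : ℕ → ℕ) (deg : ∀ n, Fin (r n) → ℤ)
      (δ : ∀ n, Hom (free 𝒜 (deg (n + 1))) (free 𝒜 (deg n))) (ε : Hom (free 𝒜 (deg 0)) M),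
      Function.Surjective ε.toLinearMap ∧ Function.Exact (δ 0).toLinearMap ε.toLinearMap ∧
      (∀ n, Function.Exact (δ (n + 1)).toLinearMap (δ n).toLinearMap) ∧
      ∀ n x i, (δ n).toLinearMap x i ∈ m.toIdeal := by
  choose r deg ε hsurj hmin using
    fun K : {K : GrMod 𝒜 // Module.Finite R K.carrier} =>
      have := K.2
      exists_minimal_cover m K.1
  let syzygy : ℕ → {K : GrMod 𝒜 // Module.Finite R K.carrier} := fun n =>
    Nat.rec ⟨M, hM⟩ (fun _ K => ⟨(ε K).ker,
      inferInstanceAs (Module.Finite R (LinearMap.ker (ε K).toLinearMap))⟩) n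
  let δ (n : ℕ) : Hom (free 𝒜 (deg (syzygy (n + 1)))) (free 𝒜 (deg (syzygy n))) :=
    ⟨(LinearMap.ker (ε (syzygy n)).toLinearMap).subtype ∘ₗ (ε (syzygy (n + 1))).toLinearMap,
      (ε (syzygy (n + 1))).map_mem⟩
  have hεδ (n : ℕ) : Function.Exact (δ n).toLinearMap (ε (syzygy n)).toLinearMap := by
    refine fun y => ⟨fun hy => ?_, ?_⟩
    · obtain ⟨x, hx⟩ := hsurj (syzygy (n + 1)) ⟨y, hy⟩
      exact ⟨x, congrArg Subtype.val hx⟩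
    · rintro ⟨x, rfl⟩
      exact ((ε (syzygy (n + 1))).toLinearMap x).2
  refine ⟨fun n => r (syzygy n), fun n => deg (syzygy n), δ, ε (syzygy 0), hsurj _, hεδ 0,
    fun n y => ?_, fun n x => hmin _ _ ((hεδ n).apply_apply_eq_zero x)⟩
  exact (map_eq_zero_iff _ (Submodule.subtype_injective _)).trans (hεδ (n + 1) y)

end GrMod

namespace DGMod

open scoped DirectSum

variable {R : Type u} [CommRing R] {𝒜 : ℤ → AddSubgroup R}

/-- The differential of the totalization of a complex of graded modules. -/
noncomputable def totalD (F : ℕ → GrMod 𝒜) (δ : ∀ n, GrMod.Hom (F (n + 1)) (F n)) :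
    (⨁ n, (F n).carrier) →ₗ[R] ⨁ n, (F n).carrier :=
  DirectSum.toModule R ℕ _ fun
    | 0 => 0
    | n + 1 => DirectSum.lof R ℕ (fun n => (F n).carrier) n ∘ₗ (δ n).toLinearMap

section TotalD

variable {F : ℕ → GrMod 𝒜} {δ : ∀ n, GrMod.Hom (F (n + 1)) (F n)}

theorem totalD_of_zero (a : (F 0).carrier) :
    totalD F δ (DirectSum.of (fun n => (F n).carrier) 0 a) = 0 := by
  rw [← DirectSum.lof_eq_of R, totalD, DirectSum.toModule_lof, LinearMap.zero_apply]

theorem totalD_of_succ (n : ℕ) (a : (F (n + 1)).carrier) :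
    totalD F δ (DirectSum.of (fun n => (F n).carrier) (n + 1) a) =
      DirectSum.of (fun n => (F n).carrier) n ((δ n).toLinearMap a) := by
  rw [← DirectSum.lof_eq_of R, totalD, DirectSum.toModule_lof]
  rfl

theorem totalD_apply (x : ⨁ n, (F n).carrier) (n : ℕ) :
    totalD F δ x n = (δ n).toLinearMap (x (n + 1)) := by
  induction x using DirectSum.induction_on with
  | zero => simp
  | add x y hx hy => rw [map_add, DirectSum.add_apply, hx, hy, DirectSum.add_apply, map_add]
  | of l a =>
    cases l with
    | zero =>
      rw [totalD_of_zero, DirectSum.of_eq_of_ne _ _ _ (Nat.succ_ne_zero n), map_zero]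
      rfl
    | succ l =>
      rw [totalD_of_succ]
      obtain rfl | h := eq_or_ne l n
      · rw [DirectSum.of_eq_same, DirectSum.of_eq_same]
      · rw [DirectSum.of_eq_of_ne _ _ _ h.symm, DirectSum.of_eq_of_ne _ _ _ (by omega), map_zero]

end TotalD

theorem of_apply_mem_grading {F : ℕ → GrMod 𝒜} {n : ℕ} {k : ℤ} {x : (F n).carrier}
    (hx : x ∈ (F n).grading k) (i : ℕ) :
    DirectSum.of (fun n => (F n).carrier) n x i ∈ (F i).grading (k + n - i) := by
  obtain rfl | h := eq_or_ne n i
  · rwa [DirectSum.of_eq_same, add_sub_cancel_right]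
  · rw [DirectSum.of_eq_of_ne _ _ _ h.symm]
    exact zero_mem _

/-- The totalization of a complex of graded modules: the direct sum of its terms, with the `n`-th
term shifted by `n`. -/
noncomputable abbrev total (F : ℕ → GrMod 𝒜) (δ : ∀ n, GrMod.Hom (F (n + 1)) (F n))
    (hδ : ∀ n x, (δ n).toLinearMap ((δ (n + 1)).toLinearMap x) = 0) : DGMod 𝒜 where
  carrier := ⨁ n, (F n).carrier
  grading k :=
    { carrier := {x | ∀ n : ℕ, x n ∈ (F n).grading (k - n)}
      add_mem' := fun hx hy i => add_mem (hx i) (hy i)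
      zero_mem' := fun _ => zero_mem _
      neg_mem' := fun hx i => neg_mem (hx i) }
  isInternal := by
    refine isInternal_of_proj (fun k => DirectSum.map fun n => (F n).proj (k - n))
      (fun k x hx => DFinsupp.ext fun n => (DirectSum.map_apply _ _ _).trans
        (GrMod.proj_of_mem (hx n)))
      (fun k l h x hx => DFinsupp.ext fun n => (DirectSum.map_apply _ _ _).trans
        (GrMod.proj_of_mem_ne (by omega) (hx n))) fun x => ?_
    induction x using DirectSum.induction_on with
    | zero => exact zero_mem _
    | add x y hx hy => exact add_mem hx hy
    | of n a =>
      induction a using GrMod.induction with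
      | zero => rw [map_zero]; exact zero_mem _
      | add x y hx hy => rw [map_add]; exact add_mem hx hy
      | hom k a ha => exact AddSubgroup.mem_iSup_of_mem (k + n) (of_apply_mem_grading ha)
  smul_mem {i j r x} hr hx n := by
    rw [add_sub_assoc]
    exact (F n).smul_mem hr (hx n)
  d := totalD F δ
  d_mem {k x} hx n := by
    have hδx := (δ n).map_mem (hx (n + 1))
    rw [totalD_apply]
    rwa [Nat.cast_succ, add_comm, ← sub_sub] at hδx
  d_d x := DFinsupp.ext fun n => by
    rw [totalD_apply, totalD_apply]
    exact hδ n _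

variable {F : ℕ → GrMod 𝒜} {δ : ∀ n, GrMod.Hom (F (n + 1)) (F n)}
  (hδ : ∀ n x, (δ n).toLinearMap ((δ (n + 1)).toLinearMap x) = 0)

/-- The morphism from the totalization of a complex of graded modules to a graded module given by
an augmentation of the complex. -/
noncomputable def totalHom {M : GrMod 𝒜} (ε : GrMod.Hom (F 0) M)
    (hε : ∀ x, ε.toLinearMap ((δ 0).toLinearMap x) = 0) : total F δ hδ ⟶ ofGrMod M where
  toLinearMap := ε.toLinearMap ∘ₗ DirectSum.component R ℕ (fun n => (F n).carrier) 0
  map_mem {k x} hx := by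
    have h : x 0 ∈ (F 0).grading (k - (0 : ℕ)) := hx 0
    rw [Nat.cast_zero, sub_zero] at h
    exact ε.map_mem h
  map_d x := (congrArg ε.toLinearMap (totalD_apply x 0)).trans (hε _)

theorem quasiIso_totalHom {M : GrMod 𝒜} (ε : GrMod.Hom (F 0) M)
    (hε : Function.Surjective ε.toLinearMap)
    (h₀ : Function.Exact (δ 0).toLinearMap ε.toLinearMap)
    (hex : ∀ n, Function.Exact (δ (n + 1)).toLinearMap (δ n).toLinearMap) :
    quasiIso 𝒜 (totalHom hδ ε h₀.apply_apply_eq_zero) := by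
  classical
  rw [quasiIso_iff]
  constructor
  · intro z _
    obtain ⟨a, ha⟩ := hε z
    refine ⟨DirectSum.of (fun n => (F n).carrier) 0 a, totalD_of_zero a, 0, ?_⟩
    rw [map_zero, add_zero, ← ha]
    exact congrArg ε.toLinearMap (DirectSum.of_eq_same (β := fun n => (F n).carrier) 0 a)
  · intro x (hx : totalD F δ x = 0) _ (hεx : ε.toLinearMap (x 0) = 0)
    have hbdry : ∀ n, ∃ y, (δ n).toLinearMap y = x n
      | 0 => (h₀ _).1 hεx
      | n + 1 => (hex n _).1 (by rw [← totalD_apply, hx]; rfl)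
    choose y hy using hbdry
    refine ⟨∑ n ∈ DFinsupp.support x, DirectSum.of (fun n => (F n).carrier) (n + 1) (y n),
      (map_sum (totalD F δ) _ _).trans ?_⟩
    refine (Finset.sum_congr rfl fun n _ => ?_).trans (DirectSum.sum_support_of x)
    rw [totalD_of_succ, hy]

section PartialHomotopy

variable {hδ} {C : DGMod 𝒜}

/-- A nullhomotopy of `f` on the summand `F n` of a totalization, where the homotopy identity is
only required on cycles, so that it does not involve the other summands. -/
def IsPartialHomotopy (f : total F δ hδ ⟶ C) (n : ℕ) (h : (F n).carrier →ₗ[R] C.carrier) : Prop :=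
  (∀ l, ∀ x ∈ (F n).grading l, h x ∈ C.grading (l + n + 1)) ∧
    ∀ x, totalD F δ (DirectSum.of _ n x) = 0 → C.d (h x) = f.toLinearMap (DirectSum.of _ n x)

variable (hF : ∀ n, (F n).HasCycleLifting) (hC : C.IsAcyclic) (f : total F δ hδ ⟶ C)
include hF hC

theorem exists_isPartialHomotopy_zero : ∃ h, IsPartialHomotopy f 0 h := by
  obtain ⟨h, hdeg, hh⟩ := hF 0 C hC (0 : ℕ)
    (f.toLinearMap ∘ₗ DirectSum.lof R ℕ (fun n => (F n).carrier) 0)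
    (fun l x hx => f.map_mem (x := DirectSum.of _ 0 x) (of_apply_mem_grading hx))
    (fun x => (f.map_d (DirectSum.of _ 0 x)).symm.trans
      ((congrArg f.toLinearMap (totalD_of_zero x)).trans (map_zero _)))
  exact ⟨h, hdeg, fun x _ => hh x⟩

theorem IsPartialHomotopy.exists_succ {n : ℕ} {h : (F n).carrier →ₗ[R] C.carrier}
    (hh : IsPartialHomotopy f n h) :
    ∃ h', IsPartialHomotopy f (n + 1) h' ∧
      ∀ x, C.d (h' x) + h ((δ n).toLinearMap x) = f.toLinearMap (DirectSum.of _ (n + 1) x) := by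
  obtain ⟨h', hdeg', hh'⟩ := hF (n + 1) C hC (n + 1 : ℕ)
    (f.toLinearMap ∘ₗ DirectSum.lof R ℕ _ (n + 1) - h ∘ₗ (δ n).toLinearMap)
    (fun l x hx => by
      have hhδ := hh.1 l _ ((δ n).map_mem hx)
      rw [add_assoc] at hhδ
      exact sub_mem (f.map_mem (of_apply_mem_grading hx)) hhδ)
    (fun x => by
      have hfδ : C.d (f.toLinearMap (DirectSum.of _ (n + 1) x)) =
          f.toLinearMap (DirectSum.of _ n ((δ n).toLinearMap x)) :=
        (f.map_d _).symm.trans (congrArg f.toLinearMap (totalD_of_succ n x))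
      have hhδ := hh.2 ((δ n).toLinearMap x) (by
        rw [← totalD_of_succ]
        exact (total F δ hδ).d_d _)
      exact (map_sub C.d _ _).trans (sub_eq_zero.2 (hfδ.trans hhδ.symm)))
  have hsum (x) : C.d (h' x) + h ((δ n).toLinearMap x) =
      f.toLinearMap (DirectSum.of _ (n + 1) x) := by
    rw [hh']
    exact sub_add_cancel _ _
  refine ⟨h', ⟨hdeg', fun x hx => ?_⟩, hsum⟩
  have hδx : (δ n).toLinearMap x = 0 := by
    rw [totalD_of_succ] at hx
    exact DirectSum.of_injective (β := fun n => (F n).carrier) n (hx.trans (map_zero _).symm)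
  rw [← hsum x, hδx, map_zero, add_zero]

theorem exists_partialHomotopies :
    ∃ h : ∀ n, (F n).carrier →ₗ[R] C.carrier, (∀ n, IsPartialHomotopy f n (h n)) ∧
      ∀ n x, C.d (h (n + 1) x) + h n ((δ n).toLinearMap x) =
        f.toLinearMap (DirectSum.of _ (n + 1) x) := by
  choose next hnext using fun n (h : {h // IsPartialHomotopy f n h}) => h.2.exists_succ hF hC
  obtain ⟨h₀, hh₀⟩ := exists_isPartialHomotopy_zero hF hC f
  let h : ∀ n, {h // IsPartialHomotopy f n h} := fun n =>
    Nat.rec ⟨h₀, hh₀⟩ (fun n h => ⟨next n h, (hnext n h).1⟩) n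
  exact ⟨fun n => (h n).1, fun n => (h n).2, fun n => (hnext n (h n)).2⟩

end PartialHomotopy

theorem isKProjective_total (hF : ∀ n, (F n).HasCycleLifting) : (total F δ hδ).IsKProjective := by
  classical
  intro C hC f
  obtain ⟨h, hh, hsucc⟩ := exists_partialHomotopies hF hC f
  let T : (⨁ n, (F n).carrier) →ₗ[R] C.carrier := DirectSum.toModule R ℕ _ h
  have hT (n) (x) : T (DirectSum.of (fun n => (F n).carrier) n x) = h n x := by
    rw [← DirectSum.lof_eq_of R, DirectSum.toModule_lof]
  refine ⟨T, fun l x (hx : ∀ n : ℕ, x n ∈ (F n).grading (l - n)) => ?_, fun x => ?_⟩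
  · rw [← DirectSum.sum_support_of x]
    refine (map_sum T _ _).symm ▸ sum_mem fun n _ => ?_
    rw [hT, ← sub_add_cancel l (n : ℤ)]
    exact (hh n).1 _ _ (hx n)
  · change C.d (T x) + T (totalD F δ x) = f.toLinearMap x
    induction x using DirectSum.induction_on with
    | zero => simp
    | add x y hx hy =>
      simp only [map_add, ← hx, ← hy]
      abel
    | of n a =>
      cases n with
      | zero =>
        rw [hT, totalD_of_zero, map_zero, add_zero]
        exact (hh 0).2 a (totalD_of_zero a)
      | succ n =>
        rw [hT, totalD_of_succ, hT]
        exact hsucc n a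

theorem IsSmall.exists_nullHomotopic_component {T : DGMod 𝒜} (h : T.IsSmall)
    (hT : T.IsKProjective) {ι : Type u} {X : ι → DGMod 𝒜} (φ : T ⟶ directSum X) :
    ∃ s : Finset ι, ∀ j ∉ s, ∃ h : T.carrier →ₗ[R] (X j).carrier,
      ∀ x, Hom.toLinearMap (φ ≫ directSumComponent X j) x = (X j).d (h x) + h (T.d x) := by
  obtain ⟨s, g, hg⟩ := h _ X ((Q 𝒜).map φ)
  obtain ⟨g, rfl⟩ := hT.exists_Q_map_eq g
  rw [← Functor.map_comp] at hg
  refine ⟨s, fun j hj => ?_⟩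
  obtain ⟨h, -, hh⟩ := (hT.homotopic_of_Q_map_eq hg.symm).comp_right (directSumComponent X j)
  have hzero (x) : Hom.toLinearMap ((g ≫ directSumIncl X s) ≫ directSumComponent X j) x = 0 :=
    (directSumInclLinear_apply X s _ j).trans (dif_neg hj)
  exact ⟨h, fun x => by rw [hh, hzero, zero_add]⟩

section Minimal

variable [GradedRing 𝒜] {r : ℕ → ℕ} {deg : ∀ n, Fin (r n) → ℤ}
  {δ : ∀ n, GrMod.Hom (GrMod.free 𝒜 (deg (n + 1))) (GrMod.free 𝒜 (deg n))}

theorem totalD_mem_smul {I : Ideal R} (hmin : ∀ n x i, (δ n).toLinearMap x i ∈ I)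
    (x : ⨁ n, (GrMod.free 𝒜 (deg n)).carrier) :
    totalD (fun n => GrMod.free 𝒜 (deg n)) δ x ∈
      I • (⊤ : Submodule R (⨁ n, (GrMod.free 𝒜 (deg n)).carrier)) := by
  induction x using DirectSum.induction_on with
  | zero => rw [map_zero]; exact zero_mem _
  | add x y hx hy => rw [map_add]; exact add_mem hx hy
  | of n a =>
    cases n with
    | zero => exact (totalD_of_zero (F := fun n => GrMod.free 𝒜 (deg n)) a).symm ▸ zero_mem _
    | succ n =>
      rw [totalD_of_succ, ← DirectSum.lof_eq_of R]
      generalize hy : (δ n).toLinearMap a = y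
      have hyI : ∀ i, y i ∈ I := fun i => hy ▸ hmin n a i
      rw [← (Pi.basisFun R (Fin (r n))).sum_repr y, map_sum]
      refine sum_mem fun i _ => ?_
      rw [map_smul]
      exact Submodule.smul_mem_smul (hyI i) trivial

variable (hδ : ∀ n x, (δ n).toLinearMap ((δ (n + 1)).toLinearMap x) = 0) {m : HomogeneousIdeal 𝒜}
  (hmin : ∀ n x i, (δ n).toLinearMap x i ∈ m.toIdeal)

/-- The shift of `R / m` through which the first coordinate of the `n`-th term of a complex of
free graded modules factors. The index is lifted to the universe of `R` as required by
`DGMod.directSum`. -/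
noncomputable abbrev shiftedQuotient (deg : ∀ n, Fin (r n) → ℤ) (m : HomogeneousIdeal 𝒜)
    (j : ULift.{u} {n : ℕ // 0 < r n}) : DGMod 𝒜 :=
  ofGrMod ((GrMod.quotient 𝒜 m).shift (deg j.down ⟨0, j.down.2⟩ + (j.down : ℕ)))

/-- The morphism from the totalization of a minimal complex of free graded modules to copies of
`R / m` given by the first coordinate of every nonzero term. -/
noncomputable def firstCoordinates :
    total (fun n => GrMod.free 𝒜 (deg n)) δ hδ ⟶ directSum (shiftedQuotient deg m) where
  toLinearMap :=
    let nonzero (j : ULift.{u} {n : ℕ // 0 < r n}) : ℕ := j.down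
    DirectSum.lmap (fun j => m.toIdeal.mkQ ∘ₗ
      (LinearMap.proj ⟨0, j.down.2⟩ : (Fin (r (nonzero j)) → R) →ₗ[R] R)) ∘ₗ
    { toFun := DFinsupp.comapDomain nonzero (Subtype.val_injective.comp ULift.down_injective)
      map_add' := DFinsupp.comapDomain_add _ _
      map_smul' := DFinsupp.comapDomain_smul _ _ }
  map_mem {k x} hx j := by
    have hxj : x (j.down : ℕ) ⟨0, j.down.2⟩ ∈
        𝒜 (k - (j.down : ℕ) - deg j.down ⟨0, j.down.2⟩) := hx j.down _ trivial
    rw [sub_sub, add_comm] at hxj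
    exact ⟨_, hxj, rfl⟩
  map_d x := DFinsupp.ext fun j => by
    refine Ideal.Quotient.eq_zero_iff_mem.2 ?_
    change totalD _ δ x j.down ⟨0, j.down.2⟩ ∈ m.toIdeal
    rw [totalD_apply]
    exact hmin _ _ _

include hmin in
theorem IsSmall.exists_bound_of_minimal (hm : m.toIdeal ≠ ⊤)
    (h : (total (fun n => GrMod.free 𝒜 (deg n)) δ hδ).IsSmall) : ∃ N, ∀ n, N < n → r n = 0 := by
  classical
  obtain ⟨s, hs⟩ := h.exists_nullHomotopic_component
    (isKProjective_total hδ fun n => GrMod.hasCycleLifting_free (deg n)) (firstCoordinates hδ hmin)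
  refine ⟨s.sup fun j => j.down.1, fun n hn => ?_⟩
  by_contra hr
  let j : ULift.{u} {n : ℕ // 0 < r n} := ⟨n, Nat.pos_of_ne_zero hr⟩
  obtain ⟨h, hh⟩ := hs j fun hj => hn.not_ge (Finset.le_sup (f := fun j => j.down.1) hj)
  let h : (⨁ n, (GrMod.free 𝒜 (deg n)).carrier) →ₗ[R] R ⧸ m.toIdeal := h
  let b : ⨁ n, (GrMod.free 𝒜 (deg n)).carrier :=
    DirectSum.of (fun n => (GrMod.free 𝒜 (deg n)).carrier) n (Pi.single ⟨0, j.down.2⟩ 1)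
  have hdb : h (totalD _ δ b) = 0 :=
    (Submodule.smul_le (P := LinearMap.ker h)).2 (fun a ha y _ => (map_smul h a y).trans
      (Module.mem_annihilator.1 (by rwa [Ideal.annihilator_quotient]) _)) (totalD_mem_smul hmin b)
  have hone : Ideal.Quotient.mk m.toIdeal (b n ⟨0, j.down.2⟩) = 0 + h (totalD _ δ b) := hh b
  rw [hdb, DirectSum.of_eq_same, Pi.single_eq_same, add_zero] at hone
  exact hm ((Ideal.eq_top_iff_one _).2 (Ideal.Quotient.eq_zero_iff_mem.1 hone))

theorem hasFiniteFreeResolution_of_isSmall [IsNoetherianRing R] (m : HomogeneousIdeal 𝒜)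
    [hm : IsLocalGraded 𝒜 m] {M : GrMod 𝒜} [Module.Finite R M.carrier]
    (h : (ofGrMod M).IsSmall) : M.HasFiniteFreeResolution := by
  obtain ⟨r, deg, δ, ε, hε, h₀, hex, hmin⟩ := GrMod.exists_minimal_resolution m M
  have hδ (n) (x) : (δ n).toLinearMap ((δ (n + 1)).toLinearMap x) = 0 :=
    (hex n).apply_apply_eq_zero x
  have hsmall : (total (fun n => GrMod.free 𝒜 (deg n)) δ hδ).IsSmall :=
    h.of_iso (Localization.Construction.wIso _ (quasiIso_totalHom hδ ε hε h₀ hex)).symm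
  obtain ⟨N, hN⟩ := hsmall.exists_bound_of_minimal hδ hmin hm.ne_top
  refine ⟨N, fun n => GrMod.free 𝒜 (deg n), δ, ε, fun n => GrMod.isFiniteFree_free _,
    fun n hn => ?_, hε, h₀, hex⟩
  have : IsEmpty (Fin (r n)) := hN n hn ▸ inferInstance
  exact inferInstanceAs (Subsingleton (Fin (r n) → R))

end Minimal

end DGMod

/-! ### Smallness and finite free resolutions -/

section

open IsLocalRing TensorProduct

variable {R : Type u} [CommRing R] {𝒜 : ℤ → AddSubgroup R}

theorem GrMod.HasFiniteFreeResolution.baseChange [Nontrivial R] {M : GrMod 𝒜}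
    (h : M.HasFiniteFreeResolution) {S : Type*} [CommRing S] [Algebra R S] [Module.Flat R S]
    {N : Type*} [AddCommGroup N] [Module S N] (e : S ⊗[R] M.carrier ≃ₗ[S] N) :
    _root_.HasFiniteFreeResolution S N := by
  obtain ⟨n, F, d, ε, hF, hn, hε, h₀, hex⟩ := h
  choose r b _ using hF
  let c : ∀ i, S ⊗[R] (F i).carrier ≃ₗ[S] (Fin (r i) → S) := fun i => ((b i).baseChange S).equivFun
  refine ⟨n, r, fun i => c i ∘ₗ (d i).toLinearMap.baseChange S ∘ₗ (c (i + 1)).symm,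
    e ∘ₗ ε.toLinearMap.baseChange S ∘ₗ (c 0).symm, fun i hi => ?_, ?_, ?_, fun i => ?_⟩
  · by_contra hr
    have := hn i hi
    exact (b i).ne_zero ⟨0, Nat.pos_of_ne_zero hr⟩ (Subsingleton.elim _ _)
  · exact e.surjective.comp ((LinearMap.lTensor_surjective S hε).comp (c 0).symm.surjective)
  · exact Function.Exact.of_ladder_linearEquiv_of_exact (e₁ := c 1) (e₂ := c 0) (e₃ := e)
      (LinearMap.ext fun x => by simp) (LinearMap.ext fun x => by simp)
      (f₁₂ := (d 0).toLinearMap.baseChange S) (f₂₃ := ε.toLinearMap.baseChange S)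
      (lTensor_exact S h₀ hε)
  · exact Function.Exact.of_ladder_linearEquiv_of_exact (e₁ := c (i + 2)) (e₂ := c (i + 1))
      (e₃ := c i) (LinearMap.ext fun x => by simp) (LinearMap.ext fun x => by simp)
      (f₁₂ := (d (i + 1)).toLinearMap.baseChange S) (f₂₃ := (d i).toLinearMap.baseChange S)
      (Module.Flat.lTensor_exact S (hex i))

theorem nonempty_baseChange_equiv_localizedModule (p : Ideal R) [p.IsPrime] (M : Type*)
    [AddCommGroup M] [Module R M] : Nonempty (Localization.AtPrime p ⊗[R] M
      ≃ₗ[Localization.AtPrime p] LocalizedModule.AtPrime p M) :=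
  ⟨(IsLocalizedModule.isBaseChange p.primeCompl (Localization.AtPrime p)
    (LocalizedModule.mkLinearMap p.primeCompl M)).equiv⟩

theorem nonempty_baseChange_equiv_adicCompletion [IsNoetherianRing R] {S : Type u} [CommRing S]
    [IsNoetherianRing S] [Algebra R S] (I : Ideal S) {M : Type u} [AddCommGroup M] [Module R M]
    [Module.Finite R M] {N : Type u} [AddCommGroup N] [Module S N] (e : S ⊗[R] M ≃ₗ[S] N) :
    Nonempty (AdicCompletion I S ⊗[R] M ≃ₗ[AdicCompletion I S] AdicCompletion I N) := by
  have : Module.Finite S N := Module.Finite.equiv e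
  exact ⟨(TensorProduct.AlgebraTensorModule.cancelBaseChange R S (AdicCompletion I S)
    (AdicCompletion I S) M).symm.trans ((e.baseChange S (AdicCompletion I S) _ _).trans
      (AdicCompletion.ofTensorProductEquivOfFiniteNoetherian I N))⟩

theorem DGMod.nonempty_homology_ofGrMod_equiv (M : GrMod 𝒜) :
    Nonempty ((DGMod.ofGrMod M).Homology ≃ₗ[R] M.carrier) := by
  have h : (LinearMap.range (DGMod.ofGrMod M).d).submoduleOf
      (LinearMap.ker (DGMod.ofGrMod M).d) = ⊥ := by
    rw [eq_bot_iff]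
    rintro x ⟨y, hy⟩
    exact Subtype.ext hy.symm
  exact ⟨(Submodule.quotEquivOfEqBot _ h).trans (LinearEquiv.ofTop _ LinearMap.ker_zero)⟩

variable [GradedRing 𝒜] [IsNoetherianRing R]

theorem DGMod.isSmall_ofGrMod_of_hasFiniteFreeResolution (m : HomogeneousIdeal 𝒜)
    [IsLocalGraded 𝒜 m] {S : Type u} [CommRing S] [Algebra R S] [IsLocalRing S] [Module.Flat R S]
    (hS : m.toIdeal.map (algebraMap R S) ≤ maximalIdeal S) {M : GrMod 𝒜}
    [Module.Finite R M.carrier] {N : Type u} [AddCommGroup N] [Module S N]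
    (e : S ⊗[R] M.carrier ≃ₗ[S] N) (h : HasFiniteFreeResolution S N) :
    (DGMod.ofGrMod M).IsSmall := by
  obtain ⟨n, hn⟩ := h.exists_projDimLT
  obtain ⟨e'⟩ := DGMod.nonempty_homology_ofGrMod_equiv M
  exact DGMod.isSmall_of_projDimLT m hS (Module.Finite.equiv e'.symm)
    (hn.of_equiv (e.symm.trans (e'.symm.baseChange R S _ _)))

theorem isSmall_tfae (m : HomogeneousIdeal 𝒜) [hm : IsLocalGraded 𝒜 m] (M : GrMod 𝒜)
    (hM : Module.Finite R M.carrier) :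
      List.TFAE [
        (DGMod.ofGrMod M).IsSmall,
        M.HasFiniteFreeResolution,
        HasFiniteFreeResolution (Localization.AtPrime m.toIdeal)
          (LocalizedModule.AtPrime m.toIdeal M.carrier),
        HasFiniteFreeResolution
          (AdicCompletion (IsLocalRing.maximalIdeal (Localization.AtPrime m.toIdeal))
            (Localization.AtPrime m.toIdeal))
          (AdicCompletion (IsLocalRing.maximalIdeal (Localization.AtPrime m.toIdeal))
            (LocalizedModule.AtPrime m.toIdeal M.carrier))] := by
  have : Nontrivial R := (Submodule.nontrivial_iff R).1 ⟨⟨_, _, hm.ne_top⟩⟩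
  obtain ⟨e⟩ := nonempty_baseChange_equiv_localizedModule m.toIdeal M.carrier
  obtain ⟨e'⟩ := nonempty_baseChange_equiv_adicCompletion
    (maximalIdeal (Localization.AtPrime m.toIdeal)) e
  have : Module.Flat (Localization.AtPrime m.toIdeal)
      (AdicCompletion (maximalIdeal (Localization.AtPrime m.toIdeal))
        (Localization.AtPrime m.toIdeal)) := AdicCompletion.flat_of_isNoetherian _
  have : Module.Flat R (AdicCompletion (maximalIdeal (Localization.AtPrime m.toIdeal))
        (Localization.AtPrime m.toIdeal)) := Module.Flat.trans R (Localization.AtPrime m.toIdeal) _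
  have hloc : m.toIdeal.map (algebraMap R (Localization.AtPrime m.toIdeal)) ≤
      maximalIdeal (Localization.AtPrime m.toIdeal) :=
    (Localization.AtPrime.map_eq_maximalIdeal (I := m.toIdeal)).le
  tfae_have 1 → 2 := DGMod.hasFiniteFreeResolution_of_isSmall m
  tfae_have 2 → 3 := fun h => h.baseChange e
  tfae_have 3 → 1 := DGMod.isSmall_ofGrMod_of_hasFiniteFreeResolution m hloc e
  tfae_have 2 → 4 := fun h => h.baseChange e'
  tfae_have 4 → 1 := DGMod.isSmall_ofGrMod_of_hasFiniteFreeResolution m (by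
    rw [IsScalarTower.algebraMap_eq R (Localization.AtPrime m.toIdeal), ← Ideal.map_map,
      AdicCompletion.maximalIdeal_eq_map]
    exact Ideal.map_mono hloc) e'
  tfae_finish

end

/-! ### Comparison of the notions of regularity -/

section

open IsLocalRing

theorem linearIndependent_toCotangent {A ι : Type*} [CommRing A] [IsLocalRing A] [Fintype ι]
    {x : ι → maximalIdeal A} (hx : Ideal.span (Set.range fun i => (x i : A)) = maximalIdeal A)
    (hmin : ∀ a : ι → A, ∑ i, a i * x i = 0 → ∀ i, a i ∈ maximalIdeal A) :
    LinearIndependent (ResidueField A)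
      fun i => ((maximalIdeal A).toCotangent (x i) : CotangentSpace A) := by
  rw [Fintype.linearIndependent_iff]
  intro g hg i
  choose a ha using fun i => residue_surjective (g i)
  obtain rfl : (fun i => residue A (a i)) = g := funext ha
  have hzero : (maximalIdeal A).toCotangent (∑ i, a i • x i) = 0 := by
    rw [map_sum, ← hg]
    exact Finset.sum_congr rfl fun i _ => map_smul _ _ _
  rw [Ideal.toCotangent_eq_zero, pow_two] at hzero
  have hmul := (congrArg (maximalIdeal A * ·) hx).ge hzero
  rw [← smul_eq_mul, Ideal.span, Submodule.mem_ideal_smul_span_iff_exists_sum] at hmul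
  obtain ⟨b, hb, hab⟩ := hmul
  rw [Finsupp.sum_fintype _ _ (by simp)] at hab
  have hsub : a i - b i ∈ maximalIdeal A := hmin (fun i => a i - b i) (by
    simp only [sub_mul, Finset.sum_sub_distrib]
    rw [sub_eq_zero]
    simpa using hab.symm) i
  exact (residue_eq_zero_iff _).2 ((Submodule.sub_mem_iff_left _ (hb i)).1 hsub)

theorem card_le_spanFinrank_maximalIdeal {A ι : Type*} [CommRing A] [IsLocalRing A]
    [IsNoetherianRing A] [Fintype ι] {x : ι → A} (hx : Ideal.span (Set.range x) = maximalIdeal A)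
    (hmin : ∀ a : ι → A, ∑ i, a i * x i = 0 → ∀ i, a i ∈ maximalIdeal A) :
    Fintype.card ι ≤ (maximalIdeal A).spanFinrank := by
  have hmem (i) : x i ∈ maximalIdeal A := hx ▸ Ideal.subset_span ⟨i, rfl⟩
  rw [spanFinrank_maximalIdeal_eq_finrank_cotangentSpace]
  exact (linearIndependent_toCotangent (x := fun i => ⟨x i, hmem i⟩) hx
    hmin).fintype_card_le_finrank

theorem spanFinrank_span_range_le {A M ι : Type*} [Semiring A] [AddCommMonoid M] [Module A M]
    [Fintype ι] (x : ι → M) :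
    (Submodule.span A (Set.range x)).spanFinrank ≤ Fintype.card ι := by
  refine (Submodule.spanFinrank_span_le_ncard_of_finite (Set.finite_range x)).trans ?_
  rw [← Set.image_univ, ← Nat.card_eq_fintype_card, ← Set.ncard_univ]
  exact Set.ncard_image_le Set.finite_univ

section AtPrime

variable {R ι : Type*} [CommRing R] {p : Ideal R} [p.IsPrime] {x : ι → R}

theorem span_algebraMap_atPrime (hx : Ideal.span (Set.range x) = p) :
    Ideal.span (Set.range fun i => algebraMap R (Localization.AtPrime p) (x i)) =
      maximalIdeal (Localization.AtPrime p) := by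
  rw [← Localization.AtPrime.map_eq_maximalIdeal]
  refine Eq.trans ?_ (congrArg (Ideal.map (algebraMap R (Localization.AtPrime p))) hx)
  rw [Ideal.map_span, ← Set.range_comp]
  rfl

theorem mem_maximalIdeal_atPrime_of_sum_mul_eq_zero [Fintype ι]
    (hmin : ∀ a : ι → R, ∑ i, a i * x i = 0 → ∀ i, a i ∈ p) (c : ι → Localization.AtPrime p)
    (hc : ∑ i, c i * algebraMap R (Localization.AtPrime p) (x i) = 0) (i : ι) :
    c i ∈ maximalIdeal (Localization.AtPrime p) := by
  obtain ⟨s, hs⟩ := IsLocalization.exist_integer_multiples_of_finite p.primeCompl c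
  choose r hr using hs
  have hsum : algebraMap R (Localization.AtPrime p) (∑ i, r i * x i) = 0 := by
    rw [map_sum, ← mul_zero (algebraMap R (Localization.AtPrime p) s), ← hc, Finset.mul_sum]
    refine Finset.sum_congr rfl fun i _ => ?_
    rw [map_mul, hr, Algebra.smul_def, mul_assoc]
  rw [IsLocalization.map_eq_zero_iff p.primeCompl] at hsum
  obtain ⟨t, ht⟩ := hsum
  have htr : t * r i ∈ p := hmin (fun i => t * r i) (by
    rw [← ht, Finset.mul_sum]
    exact Finset.sum_congr rfl fun i _ => mul_assoc _ _ _) i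
  have hri : r i ∈ p := (Ideal.IsPrime.mem_or_mem ‹_› htr).resolve_left t.2
  have hsc : algebraMap R (Localization.AtPrime p) s * c i ∈
      maximalIdeal (Localization.AtPrime p) := by
    rw [← Algebra.smul_def, ← hr, ← Localization.AtPrime.map_eq_maximalIdeal]
    exact Ideal.mem_map_of_mem _ hri
  exact (Ideal.IsPrime.mem_or_mem inferInstance hsc).resolve_left fun h =>
    (mem_maximalIdeal _).1 h (IsLocalization.map_units _ s)

theorem spanFinrank_maximalIdeal_atPrime [IsNoetherianRing R] [Fintype ι]
    (hx : Ideal.span (Set.range x) = p)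
    (hmin : ∀ a : ι → R, ∑ i, a i * x i = 0 → ∀ i, a i ∈ p) :
    (maximalIdeal (Localization.AtPrime p)).spanFinrank = Fintype.card ι :=
  le_antisymm (span_algebraMap_atPrime hx ▸ spanFinrank_span_range_le _)
    (card_le_spanFinrank_maximalIdeal (span_algebraMap_atPrime hx)
      (mem_maximalIdeal_atPrime_of_sum_mul_eq_zero hmin))

theorem isRegularLocalRing_atPrime_of_mvPolynomial_equiv {k σ : Type*} [Field k] [Finite σ]
    [Algebra k R] (e : MvPolynomial σ k ≃ₐ[k] R) : IsRegularLocalRing (Localization.AtPrime p) :=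
  have := IsRegularRing.of_ringEquiv e.toRingEquiv
  inferInstance

end AtPrime

end

section

open IsLocalRing TensorProduct

variable {R : Type u} [CommRing R] {𝒜 : ℤ → AddSubgroup R} [GradedRing 𝒜]
  (m : HomogeneousIdeal 𝒜)

theorem GrMod.finite_quotient : Module.Finite R (GrMod.quotient 𝒜 m).carrier :=
  inferInstanceAs (Module.Finite R (R ⧸ m.toIdeal))

theorem IsRegularDGAlgebra.isRegularAugmented (h : IsRegularDGAlgebra 𝒜) :
    IsRegularAugmented 𝒜 m := by
  obtain ⟨e⟩ := DGMod.nonempty_homology_ofGrMod_equiv (GrMod.quotient 𝒜 m)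
  have := GrMod.finite_quotient m
  exact h _ (Module.Finite.equiv e.symm)

theorem proj_mem_homogeneousIdeal {x : R} (hx : x ∈ m.toIdeal) (n : ℤ) :
    (GrMod.ring 𝒜).proj n x ∈ m.toIdeal := by
  have hproj := GrMod.proj_coeAddMonoidHom (M := GrMod.ring 𝒜) n (DirectSum.decompose 𝒜 x)
  rw [show DirectSum.coeAddMonoidHom 𝒜 (DirectSum.decompose 𝒜 x) = x from
    DirectSum.Decomposition.left_inv x] at hproj
  exact hproj ▸ m.isHomogeneous n hx

variable [IsNoetherianRing R] [IsLocalGraded 𝒜 m]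

theorem IsLocalGraded.exists_minimal_generators :
    ∃ (n : ℕ) (x : Fin n → R), (∀ i, SetLike.IsHomogeneousElem 𝒜 (x i)) ∧
      Ideal.span (Set.range x) = m.toIdeal ∧
      ∀ a : Fin n → R, ∑ i, a i * x i = 0 → ∀ i, a i ∈ m.toIdeal := by
  obtain ⟨n, deg, z, hz, hspan, hmin⟩ := GrMod.exists_minimal_generators m
    (M := (GrMod.ring 𝒜).ofSubmodule m.toIdeal fun n _ hx => proj_mem_homogeneousIdeal m hx n)
    (N := m.toIdeal) LinearMap.id Function.surjective_id fun x hx n => by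
      rw [LinearMap.id_apply] at hx ⊢
      rw [hx, map_zero]
  refine ⟨n, fun i => (z i).1, fun i => ⟨deg i, hz i⟩, ?_, fun a ha => hmin a (Subtype.ext ?_)⟩
  · have himage := congrArg (Submodule.map m.toIdeal.subtype) hspan
    rwa [Submodule.map_span, ← Set.range_comp, Submodule.map_top,
      Submodule.range_subtype] at himage
  · exact (map_sum m.toIdeal.subtype _ _).trans ha

theorem IsRegularLocalGraded.isRegularLocalRing (h : IsRegularLocalGraded 𝒜 m) :
    IsRegularLocalRing (Localization.AtPrime m.toIdeal) := by
  obtain ⟨n, x, -, hx, hn⟩ := h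
  refine IsRegularLocalRing.of_spanFinrank_maximalIdeal_le _ ?_
  rw [IsLocalization.AtPrime.ringKrullDim_eq_height m.toIdeal, hn, ← span_algebraMap_atPrime hx]
  exact_mod_cast (spanFinrank_span_range_le _).trans (Fintype.card_fin n).le

theorem isRegularLocalGraded_of_isRegularLocalRing
    (h : IsRegularLocalRing (Localization.AtPrime m.toIdeal)) : IsRegularLocalGraded 𝒜 m := by
  obtain ⟨n, x, hhom, hx, hmin⟩ := IsLocalGraded.exists_minimal_generators m
  refine ⟨n, x, hhom, hx, ?_⟩
  have hdim := h.spanFinrank_maximalIdeal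
  rw [IsLocalization.AtPrime.ringKrullDim_eq_height m.toIdeal,
    spanFinrank_maximalIdeal_atPrime hx hmin, Fintype.card_fin] at hdim
  exact_mod_cast hdim.symm

theorem isRegularDGAlgebra_of_isRegularLocalRing
    (h : IsRegularLocalRing (Localization.AtPrime m.toIdeal)) : IsRegularDGAlgebra 𝒜 := by
  intro M hM
  obtain ⟨n, hn⟩ := exists_projDimLT_of_isRegularLocalRing (Localization.AtPrime m.toIdeal)
    (Localization.AtPrime m.toIdeal ⊗[R] M.Homology)
  exact DGMod.isSmall_of_projDimLT m (Localization.AtPrime.map_eq_maximalIdeal).le hM hn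

theorem IsRegularAugmented.isRegularLocalRing (h : IsRegularAugmented 𝒜 m) :
    IsRegularLocalRing (Localization.AtPrime m.toIdeal) := by
  have hres := ((isSmall_tfae m (GrMod.quotient 𝒜 m) (GrMod.finite_quotient m)).out 0 2).1 h
  obtain ⟨n, hn⟩ := hres.exists_projDimLT
  obtain ⟨e⟩ := nonempty_baseChange_equiv_localizedModule m.toIdeal (R ⧸ m.toIdeal)
  let e' : (Localization.AtPrime m.toIdeal ⧸ m.toIdeal.map
      (algebraMap R (Localization.AtPrime m.toIdeal))) ≃ₗ[Localization.AtPrime m.toIdeal]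
      Localization.AtPrime m.toIdeal ⊗[R] (R ⧸ m.toIdeal) :=
    Ideal.qoutMapEquivTensorQout (Localization.AtPrime m.toIdeal)
  exact isRegularLocalRing_of_projDimLT_residueField _ (n := n) (ProjDimLT.of_equiv hn
    (e.symm.trans (e'.symm.trans
      (Submodule.quotEquivOfEq _ _ Localization.AtPrime.map_eq_maximalIdeal))))

theorem isRegularDGAlgebra_iff_isRegularAugmented :
    IsRegularDGAlgebra 𝒜 ↔ IsRegularAugmented 𝒜 m :=
  ⟨fun h => h.isRegularAugmented m, fun h =>
    isRegularDGAlgebra_of_isRegularLocalRing m (h.isRegularLocalRing m)⟩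

theorem isRegularDGAlgebra_tfae :
    List.TFAE [
      IsRegularDGAlgebra 𝒜,
      IsRegularLocalGraded 𝒜 m,
      IsRegularLocalRing (Localization.AtPrime m.toIdeal)] := by
  tfae_have 1 → 3 := fun h => (h.isRegularAugmented m).isRegularLocalRing m
  tfae_have 3 → 1 := isRegularDGAlgebra_of_isRegularLocalRing m
  tfae_have 2 → 3 := fun h => h.isRegularLocalRing m
  tfae_have 3 → 2 := isRegularLocalGraded_of_isRegularLocalRing m
  tfae_finish

end

/-! ### Graded algebras over a field -/

section

variable {R : Type u} [CommRing R] {𝒜 : ℤ → AddSubgroup R} [GradedRing 𝒜]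

theorem exists_homogeneous_coefficients {n : ℕ} {x : Fin n → R} {deg : Fin n → ℤ}
    (hx : ∀ i, x i ∈ 𝒜 (deg i)) {d : ℤ} {y : R} (hy : y ∈ 𝒜 d)
    (hspan : y ∈ Ideal.span (Set.range x)) :
    ∃ c : Fin n → R, (∀ i, c i ∈ 𝒜 (d - deg i)) ∧ ∑ i, c i * x i = y := by
  obtain ⟨c, hc⟩ := Ideal.mem_span_range_iff_exists_fun.1 hspan
  refine ⟨fun i => (GrMod.ring 𝒜).proj (d - deg i) (c i),
    fun i => GrMod.proj_mem (M := GrMod.ring 𝒜) _ _, ?_⟩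
  calc ∑ i, (GrMod.ring 𝒜).proj (d - deg i) (c i) * x i
      = ∑ i, (GrMod.ring 𝒜).proj d (c i * x i) := Finset.sum_congr rfl fun i _ => by
        have h := GrMod.proj_smul_of_mem (M := GrMod.ring 𝒜) (hx i) (d - deg i) (c i)
        rw [sub_add_cancel] at h
        exact h.symm
    _ = (GrMod.ring 𝒜).proj d y := by rw [← map_sum, hc]
    _ = y := GrMod.proj_of_mem (M := GrMod.ring 𝒜) hy

/-- The additive subgroup of elements all of whose components have positive weight. The degree `n`
has weight `w n`, so that one argument covers generators of positive degree (`w = id`) and of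
negative degree (`w = -id`). -/
def positivePart (𝒜 : ℤ → AddSubgroup R) (w : ℤ →+ ℤ) : AddSubgroup R :=
  AddSubgroup.closure {x | ∃ n, 0 < w n ∧ x ∈ 𝒜 n}

variable {w : ℤ →+ ℤ}

theorem proj_of_mem_positivePart {x : R} (hx : x ∈ positivePart 𝒜 w) {n : ℤ} (hn : w n ≤ 0) :
    (GrMod.ring 𝒜).proj n x = 0 := by
  induction hx using AddSubgroup.closure_induction with
  | mem x hx =>
    obtain ⟨l, hl, hx⟩ := hx
    refine GrMod.proj_of_mem_ne (M := GrMod.ring 𝒜) ?_ hx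
    rintro rfl
    omega
  | zero => exact map_zero _
  | add x y _ _ hx hy => rw [map_add, hx, hy, add_zero]
  | neg x _ hx => rw [map_neg, hx, neg_zero]

theorem mul_mem_positivePart {x y : R} (hx : x ∈ positivePart 𝒜 w) (hy : y ∈ positivePart 𝒜 w) :
    x * y ∈ positivePart 𝒜 w := by
  induction hx, hy using AddSubgroup.closure_induction₂ with
  | mem x y hx hy =>
    obtain ⟨i, hi, hx⟩ := hx
    obtain ⟨j, hj, hy⟩ := hy
    exact AddSubgroup.subset_closure ⟨i + j, by rw [map_add]; omega, SetLike.mul_mem_graded hx hy⟩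
  | zero_left y => rw [zero_mul]; exact zero_mem _
  | zero_right x => rw [mul_zero]; exact zero_mem _
  | add_left x y z _ _ _ h h' => rw [add_mul]; exact add_mem h h'
  | add_right x y z _ _ _ h h' => rw [mul_add]; exact add_mem h h'
  | neg_left x y _ _ h => rw [neg_mul]; exact neg_mem h
  | neg_right x y _ _ h => rw [mul_neg]; exact neg_mem h

section Algebra

variable {k : Type*} [CommRing k] [Algebra k R] (h₀ : ∀ a : k, algebraMap k R a ∈ 𝒜 0)

include h₀

theorem smul_mem_positivePart (a : k) {x : R} (hx : x ∈ positivePart 𝒜 w) :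
    a • x ∈ positivePart 𝒜 w := by
  induction hx using AddSubgroup.closure_induction with
  | mem x hx =>
    obtain ⟨n, hn, hx⟩ := hx
    refine AddSubgroup.subset_closure ⟨n, hn, ?_⟩
    rw [Algebra.smul_def]
    exact zero_add n ▸ SetLike.mul_mem_graded (h₀ a) hx
  | zero => rw [smul_zero]; exact zero_mem _
  | add x y _ _ hx hy => rw [smul_add]; exact add_mem hx hy
  | neg x _ hx => rw [smul_neg]; exact neg_mem hx

variable (hgen : Algebra.adjoin k {x : R | ∃ n : ℤ, 0 < w n ∧ x ∈ 𝒜 n} = ⊤)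

include hgen

theorem exists_algebraMap_add_positivePart (x : R) :
    ∃ a : k, ∃ y ∈ positivePart 𝒜 w, x = algebraMap k R a + y := by
  have hx : x ∈ Algebra.adjoin k {x : R | ∃ n : ℤ, 0 < w n ∧ x ∈ 𝒜 n} := hgen ▸ Algebra.mem_top
  induction hx using Algebra.adjoin_induction with
  | mem x hx => exact ⟨0, x, AddSubgroup.subset_closure hx, by simp⟩
  | algebraMap a => exact ⟨a, 0, zero_mem _, by simp⟩
  | add x y _ _ hx hy =>
    obtain ⟨a, x, hx, rfl⟩ := hx
    obtain ⟨b, y, hy, rfl⟩ := hy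
    exact ⟨a + b, x + y, add_mem hx hy, by rw [map_add]; ring⟩
  | mul x y _ _ hx hy =>
    obtain ⟨a, x, hx, rfl⟩ := hx
    obtain ⟨b, y, hy, rfl⟩ := hy
    refine ⟨a * b, a • y + b • x + x * y, add_mem (add_mem (smul_mem_positivePart h₀ a hy)
      (smul_mem_positivePart h₀ b hx)) (mul_mem_positivePart hx hy), ?_⟩
    rw [map_mul, Algebra.smul_def, Algebra.smul_def]
    ring

theorem eq_zero_of_mem_of_weight_neg {n : ℤ} (hn : w n < 0) {x : R} (hx : x ∈ 𝒜 n) : x = 0 := by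
  obtain ⟨a, y, hy, rfl⟩ := exists_algebraMap_add_positivePart h₀ hgen x
  have hproj := GrMod.proj_of_mem (M := GrMod.ring 𝒜) hx
  have hne : 0 ≠ n := by
    rintro rfl
    simp at hn
  rw [map_add, proj_of_mem_positivePart hy hn.le, add_zero,
    GrMod.proj_of_mem_ne (M := GrMod.ring 𝒜) hne (h₀ a)] at hproj
  exact hproj.symm

theorem exists_algebraMap_eq_of_mem_zero {x : R} (hx : x ∈ 𝒜 0) :
    ∃ a : k, algebraMap k R a = x := by
  obtain ⟨a, y, hy, rfl⟩ := exists_algebraMap_add_positivePart h₀ hgen x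
  have hproj := GrMod.proj_of_mem (M := GrMod.ring 𝒜) hx
  rw [map_add, proj_of_mem_positivePart hy (map_zero w).le, add_zero,
    GrMod.proj_of_mem (M := GrMod.ring 𝒜) (h₀ a)] at hproj
  exact ⟨a, hproj⟩

theorem mem_of_weight_pos (m : HomogeneousIdeal 𝒜) [hm : IsLocalGraded 𝒜 m] {n : ℤ}
    (hn : 0 < w n) {x : R} (hx : x ∈ 𝒜 n) : x ∈ m.toIdeal := by
  refine GrMod.mem_of_not_isUnit m hx fun hu => hm.ne_top ?_
  obtain ⟨z, hz⟩ := hu.exists_right_inv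
  obtain ⟨a, y, hy, rfl⟩ := exists_algebraMap_add_positivePart h₀ hgen z
  have hx' : x ∈ positivePart 𝒜 w := AddSubgroup.subset_closure ⟨n, hn, hx⟩
  have hone : (1 : R) ∈ positivePart 𝒜 w := by
    rw [← hz, mul_add, mul_comm, ← Algebra.smul_def]
    exact add_mem (smul_mem_positivePart h₀ a hx') (mul_mem_positivePart hx' hy)
  have hzero : (1 : R) = 0 :=
    (GrMod.proj_of_mem (M := GrMod.ring 𝒜) SetLike.GradedOne.one_mem).symm.trans
      (proj_of_mem_positivePart hone (map_zero w).le)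
  exact (Ideal.eq_top_iff_one _).2 (hzero ▸ zero_mem _)

end Algebra

section Field

variable {k : Type v} [Field k] [Algebra k R] (m : HomogeneousIdeal 𝒜) [hm : IsLocalGraded 𝒜 m]
  (h₀ : ∀ a : k, algebraMap k R a ∈ 𝒜 0)
  (hgen : Algebra.adjoin k {x : R | ∃ n : ℤ, 0 < w n ∧ x ∈ 𝒜 n} = ⊤) (hw : Function.Injective w)

include hm h₀ hgen hw

theorem eq_zero_or_weight_pos_of_mem {n : ℤ} {x : R} (hx : x ∈ 𝒜 n) (hxm : x ∈ m.toIdeal) :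
    x = 0 ∨ 0 < w n := by
  rcases lt_trichotomy (w n) 0 with hneg | hzero | hpos
  · exact Or.inl (eq_zero_of_mem_of_weight_neg h₀ hgen hneg hx)
  · obtain rfl := (map_eq_zero_iff w hw).1 hzero
    obtain ⟨a, rfl⟩ := exists_algebraMap_eq_of_mem_zero h₀ hgen hx
    obtain rfl : a = 0 := by
      by_contra ha
      exact hm.ne_top (Ideal.eq_top_of_isUnit_mem _ hxm ((IsUnit.mk0 a ha).map (algebraMap k R)))
    exact Or.inl (map_zero _)
  · exact Or.inr hpos

theorem mem_adjoin_of_mem {n : ℕ} {x : Fin n → R} {deg : Fin n → ℤ}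
    (hx : ∀ i, x i ∈ 𝒜 (deg i)) (hspan : Ideal.span (Set.range x) = m.toIdeal) (l : ℕ) {d : ℤ}
    (hd : w d ≤ l) {y : R} (hy : y ∈ 𝒜 d) : y ∈ Algebra.adjoin k (Set.range x) := by
  induction l generalizing d y with
  | zero =>
    rcases hd.lt_or_eq with hneg | hzero
    · rw [eq_zero_of_mem_of_weight_neg h₀ hgen (by simpa using hneg) hy]
      exact zero_mem _
    · obtain rfl := (map_eq_zero_iff w hw).1 hzero
      obtain ⟨a, rfl⟩ := exists_algebraMap_eq_of_mem_zero h₀ hgen hy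
      exact Subalgebra.algebraMap_mem _ _
  | succ l ih =>
    by_cases hd' : w d ≤ l
    · exact ih hd' hy
    obtain ⟨c, hc, rfl⟩ := exists_homogeneous_coefficients hx hy
      (hspan ▸ mem_of_weight_pos h₀ hgen m (by omega) hy)
    refine sum_mem fun i _ => ?_
    rcases eq_zero_or_weight_pos_of_mem m h₀ hgen hw (hx i)
      (hspan ▸ Ideal.subset_span ⟨i, rfl⟩) with hzero | hpos
    · rw [hzero, mul_zero]
      exact zero_mem _
    · have hlt : w (d - deg i) ≤ l := by
        rw [map_sub]
        push_cast at hd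
        omega
      exact mul_mem (ih hlt (hc i)) (Algebra.subset_adjoin ⟨i, rfl⟩)

theorem adjoin_range_eq_top {n : ℕ} {x : Fin n → R} (hx : ∀ i, SetLike.IsHomogeneousElem 𝒜 (x i))
    (hspan : Ideal.span (Set.range x) = m.toIdeal) : Algebra.adjoin k (Set.range x) = ⊤ := by
  choose deg hdeg using hx
  refine eq_top_iff.2 fun y _ => GrMod.mem_of_proj_mem (M := GrMod.ring 𝒜)
    (Algebra.adjoin k (Set.range x)).toSubring.toAddSubgroup fun d => ?_
  exact mem_adjoin_of_mem m h₀ hgen hw hdeg hspan (w d).toNat (Int.self_le_toNat _)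
    (GrMod.proj_mem (M := GrMod.ring 𝒜) _ _)

end Field

end

theorem injective_of_surjective_of_le_ringKrullDim {A k : Type*} [CommRing A] [Field k] {n : ℕ}
    (φ : MvPolynomial (Fin n) k →+* A) (hsurj : Function.Surjective φ) (hn : n ≤ ringKrullDim A) :
    Function.Injective φ := by
  rw [injective_iff_map_eq_zero]
  intro f hf
  by_contra hf0
  have hdim := ringKrullDim_succ_le_of_surjective φ hsurj (mem_nonZeroDivisors_of_ne_zero hf0) hf
  rw [MvPolynomial.ringKrullDim_of_isNoetherianRing, ringKrullDim_eq_zero_of_field, zero_add,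
    Nat.card_fin] at hdim
  have hlt : ((n : ℕ∞) : WithBot ℕ∞) + 1 ≤ n := (add_le_add_left hn 1).trans hdim
  have : n + 1 ≤ n := by exact_mod_cast hlt
  omega

section

variable {R : Type u} [CommRing R] {𝒜 : ℤ → AddSubgroup R} [GradedRing 𝒜] {k : Type v} [Field k]
  [Algebra k R] (m : HomogeneousIdeal 𝒜) [hm : IsLocalGraded 𝒜 m]

theorem IsRegularLocalGraded.isGradedPolynomialRing_of_weight (h : IsRegularLocalGraded 𝒜 m)
    {w : ℤ →+ ℤ} (hw : Function.Injective w) (h₀ : ∀ a : k, algebraMap k R a ∈ 𝒜 0)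
    (hgen : Algebra.adjoin k {x : R | ∃ n : ℤ, 0 < w n ∧ x ∈ 𝒜 n} = ⊤) :
    IsGradedPolynomialRing 𝒜 k := by
  obtain ⟨n, x, hx, hspan, hn⟩ := h
  let φ : MvPolynomial (Fin n) k →ₐ[k] R := MvPolynomial.aeval x
  have hsurj : Function.Surjective φ := by
    rw [← AlgHom.range_eq_top, ← Algebra.adjoin_range_eq_range_aeval]
    exact adjoin_range_eq_top m h₀ hgen hw hx hspan
  have hinj : Function.Injective φ := by
    refine injective_of_surjective_of_le_ringKrullDim φ.toRingHom hsurj ?_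
    exact_mod_cast hn ▸ Ideal.height_le_ringKrullDim_of_ne_top hm.ne_top
  refine ⟨n, AlgEquiv.ofBijective φ ⟨hinj, hsurj⟩, fun i => ?_⟩
  change SetLike.IsHomogeneousElem 𝒜 (φ (MvPolynomial.X i))
  rw [show φ (MvPolynomial.X i) = x i from MvPolynomial.aeval_X x i]
  exact hx i

theorem IsRegularLocalGraded.isGradedPolynomialRing (h : IsRegularLocalGraded 𝒜 m)
    (hk : IsGeneratedInOneSign 𝒜 k) : IsGradedPolynomialRing 𝒜 k := by
  obtain ⟨h₀, hgen | hgen⟩ := hk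
  · exact h.isGradedPolynomialRing_of_weight m (w := AddMonoidHom.id ℤ) Function.injective_id h₀
      hgen
  · exact h.isGradedPolynomialRing_of_weight m (w := -AddMonoidHom.id ℤ) neg_injective h₀
      (by simpa using hgen)

include hm in
theorem isRegularDGAlgebra_tfae_isGradedPolynomialRing [IsNoetherianRing R]
    (hk : IsGeneratedInOneSign 𝒜 k) :
    List.TFAE [
      IsRegularDGAlgebra 𝒜,
      IsGradedPolynomialRing 𝒜 k,
      ∃ n : ℕ, Nonempty (MvPolynomial (Fin n) k ≃ₐ[k] R)] := by
  tfae_have 1 → 2 := fun h =>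
    IsRegularLocalGraded.isGradedPolynomialRing m (((isRegularDGAlgebra_tfae m).out 0 1).1 h) hk
  tfae_have 2 → 3 := fun ⟨n, e, _⟩ => ⟨n, ⟨e⟩⟩
  tfae_have 3 → 1 := fun ⟨n, ⟨e⟩⟩ =>
    isRegularDGAlgebra_of_isRegularLocalRing m (isRegularLocalRing_atPrime_of_mvPolynomial_equiv e)
  tfae_finish

end

theorem corollaryA5_general {R : Type u} [CommRing R] [IsNoetherianRing R] (𝒜 : ℤ → AddSubgroup R)
    [GradedRing 𝒜] (m : HomogeneousIdeal 𝒜) [IsLocalGraded 𝒜 m] :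
    (∀ M : GrMod 𝒜, Module.Finite R M.carrier →
      List.TFAE [
        (DGMod.ofGrMod M).IsSmall,
        M.HasFiniteFreeResolution,
        HasFiniteFreeResolution (Localization.AtPrime m.toIdeal)
          (LocalizedModule.AtPrime m.toIdeal M.carrier),
        HasFiniteFreeResolution
          (AdicCompletion (IsLocalRing.maximalIdeal (Localization.AtPrime m.toIdeal))
            (Localization.AtPrime m.toIdeal))
          (AdicCompletion (IsLocalRing.maximalIdeal (Localization.AtPrime m.toIdeal))
            (LocalizedModule.AtPrime m.toIdeal M.carrier))]) ∧
    List.TFAE [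
      IsRegularDGAlgebra 𝒜,
      IsRegularLocalGraded 𝒜 m,
      IsRegularLocalRing (Localization.AtPrime m.toIdeal)] ∧
    (IsRegularDGAlgebra 𝒜 ↔ IsRegularAugmented 𝒜 m) ∧
    (∀ (k : Type v) [Field k] [Algebra k R], IsGeneratedInOneSign 𝒜 k →
      List.TFAE [
        IsRegularDGAlgebra 𝒜,
        IsGradedPolynomialRing 𝒜 k,
        ∃ n : ℕ, Nonempty (MvPolynomial (Fin n) k ≃ₐ[k] R)]) :=
  ⟨isSmall_tfae m, isRegularDGAlgebra_tfae m, isRegularDGAlgebra_iff_isRegularAugmented m,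
    fun _ _ _ hk => isRegularDGAlgebra_tfae_isGradedPolynomialRing m hk⟩

theorem corollaryA5 {R : Type u} [CommRing R] [IsNoetherianRing R] (𝒜 : ℤ → AddSubgroup R)
    [GradedRing 𝒜] (m : HomogeneousIdeal 𝒜) [IsLocalGraded 𝒜 m] :
    (∀ M : GrMod 𝒜, Module.Finite R M.carrier →
      List.TFAE [
        (DGMod.ofGrMod M).IsSmall,
        M.HasFiniteFreeResolution,
        HasFiniteFreeResolution (Localization.AtPrime m.toIdeal)
          (LocalizedModule.AtPrime m.toIdeal M.carrier),
        HasFiniteFreeResolution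
          (AdicCompletion (IsLocalRing.maximalIdeal (Localization.AtPrime m.toIdeal))
            (Localization.AtPrime m.toIdeal))
          (AdicCompletion (IsLocalRing.maximalIdeal (Localization.AtPrime m.toIdeal))
            (LocalizedModule.AtPrime m.toIdeal M.carrier))]) ∧
    List.TFAE [
      IsRegularDGAlgebra 𝒜,
      IsRegularLocalGraded 𝒜 m,
      IsRegularLocalRing (Localization.AtPrime m.toIdeal)] ∧
    (IsField (R ⧸ m.toIdeal) → (IsRegularDGAlgebra 𝒜 ↔ IsRegularAugmented 𝒜 m)) ∧
    (∀ (k : Type v) [Field k] [Algebra k R], IsGeneratedInOneSign 𝒜 k →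
      List.TFAE [
        IsRegularDGAlgebra 𝒜,
        IsGradedPolynomialRing 𝒜 k,
        ∃ n : ℕ, Nonempty (MvPolynomial (Fin n) k ≃ₐ[k] R)]) := by
  obtain ⟨hsmall, hreg, haug, hpoly⟩ := corollaryA5_general 𝒜 m
  exact ⟨hsmall, hreg, fun _ => haug, hpoly⟩
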